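/- **Setting.** Let $d\ge 3$ and let $V\ge 0$ be a locally integrable function on $\mathbb R^d$, not almost everywhere zero, satisfying for some $s\in[d/2,\infty]$ the reverse Hölder inequality $\big(\frac1{|B|}\int_B V^s\big)^{1/s}\le C_V\,\frac1{|B|}\int_B V$ on all balls $B$ (essential supremum on the left if $s=\infty$). Let $$\rho(x)=\sup\Big\{r>0:\ \frac1{r^{d-2}}\int_{B(x,r)}V(y)\,dy\le 1\Big\}$$ be the critical radius function. $Q(x_0,r)$ denotes the cube with centre $x_0$, side length $r$ and sides parallel to the axes; $B(x_0,r)$ is the open ball. A weight is a nonnegative locally integrable function $\omega$ that is not a.e. zero; $\omega(S)=\int_S\omega$. For $\theta>0$ and $1<p<\infty$ (with $p'=p/(p-1)$) put $$[\omega]_{A_p^{\rho,\theta}}=\sup_{B(x_0,r)}\Big(1+\frac r{\rho(x_0)}\Big)^{-\theta}\Big(\frac1{|B|}\int_B\omega\Big)^{1/p}\Big(\frac1{|B|}\int_B\omega^{-p'/p}\Big)^{1/p'},$$ and $$[\omega]_{A_1^{\rho,\theta}}=\sup_{B(x_0,r)}\Big(1+\frac r{\rho(x_0)}\Big)^{-\theta}\Big(\frac1{|B|}\int_B\omega\Big)\big(\operatorname{ess\,inf}_B\omega\big)^{-1};$$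 $\omega\in A_p^{\rho,\theta}$ means $[\omega]_{A_p^{\rho,\theta}}<\infty$. A real-valued locally integrable $f$ belongs to $\mathrm{BLO}_{\rho,\theta}$ if $$\|f\|_{\mathrm{BLO}_{\rho,\theta}}=\sup_{Q=Q(x_0,r)}\Big(1+\frac r{\rho(x_0)}\Big)^{-\theta}\frac1{|Q|}\int_Q\big[f(x)-\operatorname{ess\,inf}_Q f\big]\,dx<\infty .$$ Call $(C_0,N_0)$ with $C_0\ge1$, $N_0>0$ *admissible for $V$* if for all $x,y\in\mathbb R^d$ $$\frac1{C_0}\Big(1+\frac{|x-y|}{\rho(x)}\Big)^{-N_0}\le\frac{\rho(y)}{\rho(x)}\le C_0\Big(1+\frac{|x-y|}{\rho(x)}\Big)^{N_0/(N_0+1)} .$$ Call $(\delta,\eta,A)$ with $0<\delta<1$, $\eta>1$, $A>0$ *admissible for $\omega$* if for every cube $Q=Q(x_0,r)$ and every measurable $S\subset Q$ $$\frac{\omega(S)}{\omega(Q)}\le A\Big(\frac{|S|}{|Q|}\Big)^{\delta}\Big(1+\frac r{\rho(x_0)}\Big)^{\eta}.$$ **Theorem.** Let $1\le p<\infty$ and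 $0<\theta_2<\infty$. (0) There are $(C_0,N_0)$ admissible for $V$. For every $K\geq 0$ there is a triple $(\delta,\eta,A)$, depending only on $V,d,p,\theta_2,K$, that is admissible for every $\omega\in A_p^{\rho,\theta_2}$ with $[\omega]_{A_p^{\rho,\theta_2}}\le K$. (1) Let $(C_0,N_0)$ be admissible for $V$, and let $0<\delta<1$, $\eta>1$, $A>0$ and $0<\theta_1<\infty$. There is a constant $C>0$, depending only on $V,d,p,\theta_1,\theta_2,C_0,N_0,\delta,\eta,A$, such that for all $\omega\in A_p^{\rho,\theta_2}$ for which $(\delta,\eta,A)$ is admissible, all $f\in\mathrm{BLO}_{\rho,\theta_1}$ and all cubes $Q=Q(x_0,r)$, $$\Big(\frac1{\omega(Q)}\int_Q\big[f(x)-\operatorname{ess\,inf}_Q f\big]^p\omega(x)\,dx\Big)^{1/p}\le C[\omega]_{A_p^{\rho,\theta_2}}\Big(1+\frac r{\rho(x_0)}\Big)^{(N_0+1)\theta_1+\eta/p}\|f\|_{\mathrm{BLO}_{\rho,\theta_1}} .$$ (2) Conversely, there is a constant $c>0$, depending only on $V,d,p,\theta_2$, such that for all $\omega\in A_p^{\rho,\theta_2}$,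 all measurable $f:\mathbb R^d\to\mathbb R$, all $\theta_1>0$ and all $C>0$: if for every cube $Q=Q(x_0,r)$ $$\Big(\frac1{\omega(Q)}\int_Q\big[f(x)-\operatorname{ess\,inf}_Q f\big]^p\omega(x)\,dx\Big)^{1/p}\le C[\omega]_{A_p^{\rho,\theta_2}}\Big(1+\frac r{\rho(x_0)}\Big)^{\theta_1-\theta_2},$$ then $f\in\mathrm{BLO}_{\rho,\theta_1}$ and $\|f\|_{\mathrm{BLO}_{\rho,\theta_1}}\le C'[\omega]_{A_p^{\rho,\theta_2}}$ with $C'=c\,C\,[\omega]_{A_p^{\rho,\theta_2}}$. -/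

import Mathlib

open MeasureTheory Set
open scoped ENNReal NNReal

noncomputable section

namespace SchrodingerBLO

/-- The Euclidean space of dimension `d`. -/
abbrev E (d : ℕ) : Type := EuclideanSpace ℝ (Fin d)

/-- The cube with centre `x₀`, side length `r` and sides parallel to the coordinate axes. -/
def cube {d : ℕ} (x₀ : E d) (r : ℝ) : Set (E d) := {x | ∀ i, |x i - x₀ i| ≤ r / 2}

/-- The reverse Hölder inequality of exponent `s` in `(1, ∞]` on all balls. The averages are norms
with respect to the normalized Lebesgue measure on the ball; for `s = ∞` the left side is the
essential supremum. -/
def ReverseHolder {d : ℕ} (s : ℝ≥0∞) (V : E d → ℝ) : Prop :=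
  ∃ C : ℝ, 0 < C ∧ ∀ (x : E d) (r : ℝ), 0 < r →
    eLpNorm V s ((volume (Metric.ball x r))⁻¹ • volume.restrict (Metric.ball x r))
      ≤ ENNReal.ofReal C *
        eLpNorm V 1 ((volume (Metric.ball x r))⁻¹ • volume.restrict (Metric.ball x r))

/-- The critical radius function of the potential `V`. -/
def criticalRadius {d : ℕ} (V : E d → ℝ) (x : E d) : ℝ :=
  sSup {r : ℝ | 0 < r ∧ 1 / r ^ (d - 2) * ∫ y in Metric.ball x r, V y ≤ 1}

/-- The two-sided comparison of the values of `ρ` at two points, with constants `C₀` and `N₀`. -/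
def RadiusComparison {d : ℕ} (ρ : E d → ℝ) (C₀ N₀ : ℝ) : Prop :=
  ∀ x y : E d,
    1 / C₀ * (1 + ‖x - y‖ / ρ x) ^ (-N₀) ≤ ρ y / ρ x ∧
      ρ y / ρ x ≤ C₀ * (1 + ‖x - y‖ / ρ x) ^ (N₀ / (N₀ + 1))

/-- The weighted measure `ω(S)` of a set `S`. -/
def weightedMeasure {d : ℕ} (ω : E d → ℝ) (S : Set (E d)) : ℝ≥0∞ :=
  ∫⁻ x in S, ENNReal.ofReal (ω x)

/-- The Muckenhoupt quantity of `ω` on a set `B`. A negative power of `0` and `0⁻¹` are `∞`. -/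
def muckenhoupt {d : ℕ} (p : ℝ) (ω : E d → ℝ) (B : Set (E d)) : ℝ≥0∞ :=
  if p = 1 then
    (⨍⁻ x in B, ENNReal.ofReal (ω x) ∂volume) *
      (essInf (fun x => ENNReal.ofReal (ω x)) (volume.restrict B))⁻¹
  else
    (⨍⁻ x in B, ENNReal.ofReal (ω x) ∂volume) ^ (1 / p) *
      (⨍⁻ x in B, ENNReal.ofReal (ω x) ^ (-((p / (p - 1)) / p)) ∂volume) ^ (1 / (p / (p - 1)))

/-- The characteristic constant `[ω]` of the class `A_p^{ρ,θ}`, a supremum over all balls. -/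
def apConst {d : ℕ} (p : ℝ) (ρ : E d → ℝ) (θ : ℝ) (ω : E d → ℝ) : ℝ≥0∞ :=
  ⨆ (x₀ : E d) (r : ℝ) (_ : 0 < r),
    ENNReal.ofReal ((1 + r / ρ x₀) ^ (-θ)) * muckenhoupt p ω (Metric.ball x₀ r)

/-- Membership in `A_p^{ρ,θ}`: `ω` is a weight, that is a nonnegative locally integrable function
that is not almost everywhere zero, and its characteristic constant is finite. -/
structure MemAp {d : ℕ} (p : ℝ) (ρ : E d → ℝ) (θ : ℝ) (ω : E d → ℝ) : Prop where
  nonneg : ∀ x, 0 ≤ ω x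
  locallyIntegrable : LocallyIntegrable ω volume
  ne_zero : ¬ (ω =ᵐ[volume] 0)
  apConst_lt_top : apConst p ρ θ ω < ∞

/-- The comparison of the weighted measure with the Lebesgue measure on measurable subsets of
cubes, with exponents `δ`, `η` and constant `A`. -/
def WeightComparison {d : ℕ} (ρ : E d → ℝ) (ω : E d → ℝ) (δ η A : ℝ) : Prop :=
  ∀ (x₀ : E d) (r : ℝ), 0 < r → ∀ S : Set (E d), MeasurableSet S → S ⊆ cube x₀ r →
    weightedMeasure ω S / weightedMeasure ω (cube x₀ r)
      ≤ ENNReal.ofReal A * (volume S / volume (cube x₀ r)) ^ δ *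
        ENNReal.ofReal ((1 + r / ρ x₀) ^ η)

/-- The difference `f x - essinf_Q f`. The essential infimum is taken in the extended reals, so the
difference is `∞` when `f` is not essentially bounded below on `Q`. -/
def lowerOsc {d : ℕ} (f : E d → ℝ) (Q : Set (E d)) (x : E d) : ℝ≥0∞ :=
  ((f x : EReal) - essInf (fun y => (f y : EReal)) (volume.restrict Q)).toENNReal

/-- The `BLO_{ρ,θ}` constant of `f`, a supremum over all cubes. -/
def bloNorm {d : ℕ} (ρ : E d → ℝ) (θ : ℝ) (f : E d → ℝ) : ℝ≥0∞ :=
  ⨆ (x₀ : E d) (r : ℝ) (_ : 0 < r),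
    ENNReal.ofReal ((1 + r / ρ x₀) ^ (-θ)) *
      ⨍⁻ x in cube x₀ r, lowerOsc f (cube x₀ r) x ∂volume

/-- Membership in `BLO_{ρ,θ}`. -/
def MemBLO {d : ℕ} (ρ : E d → ℝ) (θ : ℝ) (f : E d → ℝ) : Prop :=
  LocallyIntegrable f volume ∧ bloNorm ρ θ f < ∞

/-- The weighted `p`-th power average of `f - essinf_Q f` over a set `Q`. -/
def weightedLowerOsc {d : ℕ} (p : ℝ) (ω f : E d → ℝ) (Q : Set (E d)) : ℝ≥0∞ :=
  ((weightedMeasure ω Q)⁻¹ * ∫⁻ x in Q, lowerOsc f Q x ^ p * ENNReal.ofReal (ω x)) ^ (1 / p)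

end SchrodingerBLO

end

namespace SchrodingerBLO
open Filter Topology

variable {d : ℕ}

/-! Write u = 1 + r/ρ(x₀). Three mechanisms carry the theorem: Hölder's inequality against the
weight, Calderón–Zygmund stopping cubes, and the slow variation of ρ.

Part (2) is Hölder (`lintegral_mul_weightedMeasure_rpow_le`): passing from a weighted p-average to a
plain average on Q costs a constant times [ω] u^θ₂, and u^θ₂ cancels the negative exponent in the
hypothesis.

Part (1) is John–Nirenberg plus summation over layers. For y in Q the radius ρ(y) is at least a
constant times u^(-N₀) ρ(x₀), so every subcube of Q has mean lower oscillation at most L, a constant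
times u^((N₀+1)θ₁) ‖f‖. Hence {f - essinf f > k 2^(d+1) L} has relative volume at most 2^(-k)
(`volume_lowerOsc_gt_le`). The weight comparison turns this into relative mass A u^η 2^(-kδ);
summing over k and taking a p-th root gives the exponent (N₀+1)θ₁ + η/p. The factor [ω] is free
because it is bounded below by 2^(-θ₂).

Part (0), weights: on a cube no larger than ρ at its centre the weight behaves as an ordinary A_p
weight, so a subset of half the volume misses a fixed share of the mass. Stopping cubes iterate this
into a power law (`measure_le_pow_mul_of_forall_subcube`). In a large cube only sets that are small
compared with the subcritical scale are iterated; the ratio of the scales is a power of u and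
produces η.

Part (0), radius: let μ and W have densities V and V^q with q = d/2. Hölder and reverse Hölder make
φ(x,r) = r^(2-d) μ(B(x,r)) comparable to W(B(x,r))^(1/q). Doubling of μ bounds the growth of φ from
above. Reverse doubling of W bounds it from below by a positive power, also in the borderline case s
= d/2, where Hölder alone gives exponent 0. Power growth in both directions makes the radius at
which φ crosses 1 positive, finite and slowly varying (`exists_radiusComparison_of_growth`). -/

/-! ### Cubes and balls -/

theorem cube_eq_preimage (x₀ : E d) {r : ℝ} (hr : 0 ≤ r) :
    cube x₀ r = (WithLp.ofLp : E d → Fin d → ℝ) ⁻¹' Metric.closedBall (WithLp.ofLp x₀) (r / 2) := by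
  ext x
  simp only [cube, mem_ofPred_eq, mem_preimage, Metric.mem_closedBall]
  rw [dist_pi_le_iff (by positivity)]
  simp [Real.dist_eq]

theorem measurableSet_cube (x₀ : E d) (r : ℝ) : MeasurableSet (cube x₀ r) := by
  have : cube x₀ r = ⋂ i, {x : E d | |x i - x₀ i| ≤ r / 2} := by
    ext x; simp [cube]
  rw [this]
  refine MeasurableSet.iInter fun i => measurableSet_le ?_ measurable_const
  fun_prop

theorem volume_cube (x₀ : E d) {r : ℝ} (hr : 0 ≤ r) :
    volume (cube x₀ r) = ENNReal.ofReal (r ^ d) := by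
  rw [cube_eq_preimage x₀ hr, (PiLp.volume_preserving_ofLp (Fin d)).measure_preimage
    Metric.isClosed_closedBall.nullMeasurableSet, Real.volume_pi_closedBall _ (by positivity)]
  simp [mul_div_cancel₀]

theorem volume_cube_ne_zero (x₀ : E d) {r : ℝ} (hr : 0 < r) : volume (cube x₀ r) ≠ 0 := by
  rw [volume_cube x₀ hr.le]
  simpa using pow_pos hr d

theorem volume_cube_ne_top (x₀ : E d) {r : ℝ} (hr : 0 ≤ r) : volume (cube x₀ r) ≠ ∞ := by
  rw [volume_cube x₀ hr]
  exact ENNReal.ofReal_ne_top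

theorem isCompact_cube (x₀ : E d) {r : ℝ} (hr : 0 ≤ r) : IsCompact (cube x₀ r) := by
  rw [cube_eq_preimage x₀ hr]
  exact (PiLp.homeomorph 2 (fun _ : Fin d => ℝ)).isCompact_preimage.2 (isCompact_closedBall _ _)

theorem mem_cube_self (x₀ : E d) {r : ℝ} (hr : 0 ≤ r) : x₀ ∈ cube x₀ r := by
  intro i; simp; positivity

theorem norm_sub_le_of_mem_cube {x₀ x : E d} {r : ℝ} (hr : 0 ≤ r) (hx : x ∈ cube x₀ r) :
    ‖x - x₀‖ ≤ √d * (r / 2) := by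
  rw [EuclideanSpace.norm_eq]
  have : ∑ i, ‖(x - x₀) i‖ ^ 2 ≤ d * (r / 2) ^ 2 := by
    calc ∑ i, ‖(x - x₀) i‖ ^ 2 ≤ ∑ _i : Fin d, (r / 2) ^ 2 := by
          refine Finset.sum_le_sum fun i _ => ?_
          have := hx i
          simp only [PiLp.sub_apply, Real.norm_eq_abs]
          gcongr
      _ = _ := by simp
  calc _ ≤ √(d * (r / 2) ^ 2) := Real.sqrt_le_sqrt this
    _ = _ := by rw [Real.sqrt_mul (by positivity), Real.sqrt_sq (by positivity)]

theorem cube_subset_ball (hd : 0 < d) (x₀ : E d) {r : ℝ} (hr : 0 < r) :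
    cube x₀ r ⊆ Metric.ball x₀ (√d * r) := by
  intro x hx
  rw [Metric.mem_ball, dist_eq_norm]
  refine (norm_sub_le_of_mem_cube hr.le hx).trans_lt ?_
  have : 0 < √(d : ℝ) := by positivity
  gcongr
  linarith

theorem ball_subset_cube (x₀ : E d) (r : ℝ) :
    Metric.ball x₀ r ⊆ cube x₀ (2 * r) := by
  intro x hx i
  rw [Metric.mem_ball, dist_eq_norm] at hx
  have := PiLp.norm_apply_le (x - x₀) i
  simp only [PiLp.sub_apply, Real.norm_eq_abs] at this
  linarith

/-! ### Lebesgue differentiation and dyadic subcubes -/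

/-- Lebesgue differentiation along cubes that contain the point. -/
theorem ae_tendsto_lintegral_cube_div {h : E d → ℝ≥0∞} (hh : AEMeasurable h)
    (h_top : ∫⁻ x, h x ≠ ∞) :
    ∀ᵐ x : E d, ∀ (c : ℕ → E d) (δ : ℕ → ℝ), (∀ n, 0 < δ n) → Tendsto δ atTop (𝓝 0) →
      (∀ n, x ∈ cube (c n) (δ n)) →
      Tendsto (fun n => (∫⁻ y in cube (c n) (δ n), h y) / volume (cube (c n) (δ n))) atTop
        (𝓝 (h x)) := by
  have hT := PiLp.volume_preserving_toLp (Fin d)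
  have hO := PiLp.volume_preserving_ofLp (Fin d)
  have h1 : AEMeasurable (fun y : Fin d → ℝ => h (WithLp.toLp 2 y)) :=
    hh.comp_quasiMeasurePreserving hT.quasiMeasurePreserving
  have hemb : MeasurableEmbedding (WithLp.toLp 2 : (Fin d → ℝ) → E d) :=
    (MeasurableEquiv.toLp 2 (Fin d → ℝ)).measurableEmbedding
  have h2 : ∫⁻ y : Fin d → ℝ, h (WithLp.toLp 2 y) ≠ ∞ := by
    rwa [hT.lintegral_comp_emb hemb]
  have key := (IsUnifLocDoublingMeasure.vitaliFamily
    (volume : Measure (Fin d → ℝ)) 1).ae_tendsto_lintegral_div h1 h2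
  filter_upwards [hO.quasiMeasurePreserving.ae key] with x hx c δ hδ hδ0 hmem
  have h3 : Tendsto (fun n => Metric.closedBall (WithLp.ofLp (c n)) (δ n / 2)) atTop
      ((IsUnifLocDoublingMeasure.vitaliFamily
        (volume : Measure (Fin d → ℝ)) 1).filterAt (WithLp.ofLp x)) := by
    refine IsUnifLocDoublingMeasure.tendsto_closedBall_filterAt _ _ _ ?_ ?_
    · refine tendsto_nhdsWithin_iff.2 ⟨by simpa using hδ0.div_const 2, Eventually.of_forall ?_⟩
      intro n
      exact half_pos (hδ n)
    · refine Eventually.of_forall fun n => ?_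
      have := hmem n
      rw [cube_eq_preimage _ (hδ n).le] at this
      simpa using this
  refine (hx.comp h3).congr fun n => ?_
  simp only [Function.comp]
  rw [volume_cube _ (hδ n).le, Real.volume_pi_closedBall _ (by linarith [hδ n])]
  congr 1
  · rw [cube_eq_preimage _ (hδ n).le, ← hT.setLIntegral_comp_preimage_emb hemb]
    rfl
  · simp [mul_div_cancel₀]

theorem ae_coord_notMem {S : Set ℝ} (hS : S.Countable) (i : Fin d) : ∀ᵐ x : E d, x i ∉ S := by
  have h1 : ∀ᵐ t : ℝ, t ∉ S := measure_eq_zero_iff_ae_notMem.1 (hS.measure_zero _)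
  have h2 : ∀ᵐ y : Fin d → ℝ, y i ∉ S :=
    (Measure.quasiMeasurePreserving_eval (fun _ : Fin d => (volume : Measure ℝ)) i).ae h1
  exact (PiLp.volume_preserving_ofLp (Fin d)).quasiMeasurePreserving.ae h2

/-- The centre of the dyadic subcube of `cube x₀ r` of generation `n` and index `k`. -/
noncomputable def dyadicCenter (x₀ : E d) (r : ℝ) (n : ℕ) (k : Fin d → ℤ) : E d :=
  WithLp.toLp 2 fun i => x₀ i - r / 2 + r / 2 ^ n * (k i + 1 / 2)

/-- The index of the dyadic subcube of generation `n` that contains `x`. -/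
noncomputable def dyadicIndex (x₀ : E d) (r : ℝ) (n : ℕ) (x : E d) : Fin d → ℤ :=
  fun i => ⌊(x i - (x₀ i - r / 2)) / (r / 2 ^ n)⌋

/-- The dyadic subcube of generation `n` and index `k`. -/
def dyadicCube (x₀ : E d) (r : ℝ) (n : ℕ) (k : Fin d → ℤ) : Set (E d) :=
  cube (dyadicCenter x₀ r n k) (r / 2 ^ n)

/-- The points that lie on no dyadic hyperplane. -/
def DyadicGeneric (x₀ : E d) (r : ℝ) (x : E d) : Prop :=
  ∀ (n : ℕ) (i : Fin d) (m : ℤ), x i ≠ x₀ i - r / 2 + r / 2 ^ n * m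

theorem mem_dyadicCube_iff {x₀ : E d} {r : ℝ} (hr : 0 < r) {n : ℕ} {k : Fin d → ℤ} {x : E d} :
    x ∈ dyadicCube x₀ r n k ↔ ∀ i, (k i : ℝ) ≤ (x i - (x₀ i - r / 2)) / (r / 2 ^ n) ∧
      (x i - (x₀ i - r / 2)) / (r / 2 ^ n) ≤ k i + 1 := by
  have h2 : 0 < r / 2 ^ n := by positivity
  refine forall_congr' fun i => ?_
  rw [le_div_iff₀ h2, div_le_iff₀ h2, abs_le]
  simp only [dyadicCenter]
  constructor <;> rintro ⟨h, h'⟩ <;> constructor <;> linarith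

theorem mem_dyadicCube_dyadicIndex (x₀ : E d) {r : ℝ} (hr : 0 < r) (n : ℕ) (x : E d) :
    x ∈ dyadicCube x₀ r n (dyadicIndex x₀ r n x) := by
  rw [mem_dyadicCube_iff hr]
  exact fun i => ⟨Int.floor_le _, (Int.lt_floor_add_one _).le⟩

/-- Closed dyadic cubes share faces, so a point determines its cube only off the dyadic hyperplanes.
Those form a null set, which is why all later arguments run over generic points. -/
theorem DyadicGeneric.dyadicIndex_eq {x₀ : E d} {r : ℝ} (hr : 0 < r) {x : E d}
    (hx : DyadicGeneric x₀ r x) {n : ℕ} {k : Fin d → ℤ} (hxk : x ∈ dyadicCube x₀ r n k) :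
    dyadicIndex x₀ r n x = k := by
  rw [mem_dyadicCube_iff hr] at hxk
  funext i
  refine Int.floor_eq_iff.2 ⟨(hxk i).1, lt_of_le_of_ne (hxk i).2 fun h => ?_⟩
  have h2 : 0 < r / 2 ^ n := by positivity
  rw [div_eq_iff h2.ne'] at h
  refine hx n i (k i + 1) ?_
  push_cast
  linarith

theorem ae_dyadicGeneric (x₀ : E d) (r : ℝ) : ∀ᵐ x : E d, DyadicGeneric x₀ r x := by
  have : ∀ᵐ x : E d, ∀ i, x i ∉ range fun q : ℕ × ℤ => x₀ i - r / 2 + r / 2 ^ q.1 * q.2 :=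
    ae_all_iff.2 fun i => ae_coord_notMem (countable_range _) i
  filter_upwards [this] with x hx n i m h
  exact hx i ⟨(n, m), h.symm⟩

/-- This is ⌊t⌋ = ⌊⌊2t⌋ / 2⌋; integer division by 2 rounds down for negative indices as well. The
nesting of the generations rests on it. -/
theorem dyadicIndex_eq_ediv (x₀ : E d) {r : ℝ} (n : ℕ) (x : E d) (i : Fin d) :
    dyadicIndex x₀ r n x i = dyadicIndex x₀ r (n + 1) x i / 2 := by
  simp only [dyadicIndex]
  set t := (x i - (x₀ i - r / 2)) / (r / 2 ^ n) with ht
  have : (x i - (x₀ i - r / 2)) / (r / 2 ^ (n + 1)) = 2 * t := by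
    rw [ht, pow_succ, div_div_eq_mul_div, div_div_eq_mul_div]; ring
  rw [this, Int.floor_eq_iff]
  have h1 := Int.floor_le (2 * t)
  have h2 := Int.lt_floor_add_one (2 * t)
  have h3 : 2 * (⌊2 * t⌋ / 2) ≤ ⌊2 * t⌋ := by omega
  have h4 : ⌊2 * t⌋ + 1 ≤ 2 * (⌊2 * t⌋ / 2) + 2 := by omega
  have h3' : (2 : ℝ) * ((⌊2 * t⌋ / 2 : ℤ) : ℝ) ≤ ⌊2 * t⌋ := by exact_mod_cast h3
  have h4' : (⌊2 * t⌋ : ℝ) + 1 ≤ 2 * ((⌊2 * t⌋ / 2 : ℤ) : ℝ) + 2 := by exact_mod_cast h4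
  constructor <;> linarith

theorem dyadicIndex_eq_of_le {x₀ : E d} {r : ℝ} {m n : ℕ} (hmn : m ≤ n) {x y : E d}
    (h : dyadicIndex x₀ r n x = dyadicIndex x₀ r n y) :
    dyadicIndex x₀ r m x = dyadicIndex x₀ r m y := by
  induction n, hmn using Nat.le_induction with
  | base => exact h
  | succ n _ ih =>
    refine ih (funext fun i => ?_)
    rw [dyadicIndex_eq_ediv, dyadicIndex_eq_ediv x₀ n y, h]

theorem dyadicCube_succ_subset (x₀ : E d) {r : ℝ} (hr : 0 < r) (n : ℕ) (x : E d) :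
    dyadicCube x₀ r (n + 1) (dyadicIndex x₀ r (n + 1) x) ⊆
      dyadicCube x₀ r n (dyadicIndex x₀ r n x) := by
  intro y hy
  rw [mem_dyadicCube_iff hr] at hy ⊢
  intro i
  have hyi := hy i
  rw [dyadicIndex_eq_ediv]
  set t := (y i - (x₀ i - r / 2)) / (r / 2 ^ n) with ht
  have : (y i - (x₀ i - r / 2)) / (r / 2 ^ (n + 1)) = 2 * t := by
    rw [ht, pow_succ, div_div_eq_mul_div, div_div_eq_mul_div]; ring
  rw [this] at hyi
  set k := dyadicIndex x₀ r (n + 1) x i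
  have h3 : 2 * (k / 2) ≤ k := by omega
  have h4 : k + 1 ≤ 2 * (k / 2) + 2 := by omega
  have h3' : (2 : ℝ) * ((k / 2 : ℤ) : ℝ) ≤ k := by exact_mod_cast h3
  have h4' : (k : ℝ) + 1 ≤ 2 * ((k / 2 : ℤ) : ℝ) + 2 := by exact_mod_cast h4
  constructor <;> linarith [hyi.1, hyi.2]

theorem dyadicCube_zero (x₀ : E d) (r : ℝ) : dyadicCube x₀ r 0 0 = cube x₀ r := by
  simp only [dyadicCube, pow_zero, div_one]
  congr 1
  ext i
  simp only [dyadicCenter, Pi.zero_apply, Int.cast_zero]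
  ring

theorem DyadicGeneric.dyadicCube_subset {x₀ : E d} {r : ℝ} (hr : 0 < r) {x : E d}
    (hx : DyadicGeneric x₀ r x) (hxQ : x ∈ cube x₀ r) (n : ℕ) :
    dyadicCube x₀ r n (dyadicIndex x₀ r n x) ⊆ cube x₀ r := by
  induction n with
  | zero =>
    rw [← dyadicCube_zero] at hxQ
    rw [hx.dyadicIndex_eq hr hxQ, dyadicCube_zero]
  | succ n ih => exact (dyadicCube_succ_subset x₀ hr n x).trans ih

theorem volume_dyadicCube_eq (x₀ : E d) {r : ℝ} (hr : 0 < r) (n : ℕ) (k l : Fin d → ℤ) :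
    volume (dyadicCube x₀ r n k) = 2 ^ d * volume (dyadicCube x₀ r (n + 1) l) := by
  rw [dyadicCube, dyadicCube, volume_cube _ (by positivity), volume_cube _ (by positivity)]
  rw [show (2 : ℝ≥0∞) ^ d = ENNReal.ofReal (2 ^ d) by
    rw [ENNReal.ofReal_pow (by norm_num)]; simp]
  rw [← ENNReal.ofReal_mul (by positivity), ← mul_pow]
  congr 2
  rw [pow_succ]; field_simp

/-! ### Stopping cubes and decay of mass -/

/-- **Calderón–Zygmund decomposition** of a cube for a function with average at most `a`. -/
theorem exists_calderonZygmund_cubes (x₀ : E d) {r : ℝ} (hr : 0 < r) {h : E d → ℝ≥0∞}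
    (hh : AEMeasurable h) {a : ℝ≥0∞} (ha_top : a ≠ ∞)
    (ha : ∫⁻ x in cube x₀ r, h x ≤ a * volume (cube x₀ r)) :
    ∃ T : Set (E d × ℝ), T.Countable ∧
      (∀ q ∈ T, 0 < q.2 ∧ cube q.1 q.2 ⊆ cube x₀ r ∧
        a * volume (cube q.1 q.2) < ∫⁻ x in cube q.1 q.2, h x ∧
        ∫⁻ x in cube q.1 q.2, h x ≤ 2 ^ d * a * volume (cube q.1 q.2)) ∧
      T.Pairwise (Function.onFun (AEDisjoint volume) fun q => cube q.1 q.2) ∧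
      ∀ᵐ x : E d, x ∈ cube x₀ r → x ∉ ⋃ q ∈ T, cube q.1 q.2 → h x ≤ a := by
  set P : ℕ → (Fin d → ℤ) → Prop := fun n k =>
    a * volume (dyadicCube x₀ r n k) < ∫⁻ x in dyadicCube x₀ r n k, h x with hP
  -- Stopping rule: the first generation whose average exceeds `a`. The generic witness `x` in the
  -- cube encodes both the chain of ancestors and the inclusion in `cube x₀ r`.
  set I : Set (ℕ × (Fin d → ℤ)) := {q | ∃ x ∈ cube x₀ r, DyadicGeneric x₀ r x ∧
    dyadicIndex x₀ r q.1 x = q.2 ∧ P q.1 q.2 ∧ ∀ m < q.1, ¬ P m (dyadicIndex x₀ r m x)} with hI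
  set F : ℕ × (Fin d → ℤ) → E d × ℝ := fun q => (dyadicCenter x₀ r q.1 q.2, r / 2 ^ q.1) with hF
  have hgen := ae_dyadicGeneric x₀ r
  refine ⟨F '' I, (to_countable I).image F, ?_, ?_, ?_⟩
  · rintro _ ⟨⟨n, k⟩, ⟨x, hxQ, hx, hxk, hPk, hlt⟩, rfl⟩
    simp only at hxk hPk hlt
    subst hxk
    refine ⟨by simp only [hF]; positivity, hx.dyadicCube_subset hr hxQ n, hPk, ?_⟩
    change ∫⁻ x in dyadicCube x₀ r n _, h x ≤ _ * volume (dyadicCube x₀ r n _)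
    cases n with
    | zero =>
      -- Generation 0 is the whole cube, whose average is at most `a`, so it is never selected and
      -- each selected cube has a parent.
      exfalso
      rw [← dyadicCube_zero] at hxQ
      rw [hx.dyadicIndex_eq hr hxQ] at hPk
      simp only [hP, dyadicCube_zero] at hPk
      exact absurd ha (not_le.2 hPk)
    | succ n =>
      -- The parent was not selected, and its volume is 2^d times that of the child.
      have := hlt n (Nat.lt_succ_self n)
      simp only [hP, not_lt] at this
      rw [volume_dyadicCube_eq x₀ hr n _ (dyadicIndex x₀ r (n + 1) x), ← mul_assoc,
        mul_comm a] at this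
      exact (lintegral_mono_set (dyadicCube_succ_subset x₀ hr n x)).trans this
  · rintro _ ⟨⟨n, k⟩, ⟨x, hxQ, hx, hxk, hPk, hlt⟩, rfl⟩ _ ⟨⟨n', k'⟩, ⟨x', hxQ', hx', hxk', hPk', hlt'⟩, rfl⟩ hne
    simp only at hxk hPk hlt hxk' hPk' hlt'
    change volume (dyadicCube x₀ r n k ∩ dyadicCube x₀ r n' k') = 0
    -- A generic common point would make one of two selected cubes of different generations an
    -- ancestor of the other, against minimality; in equal generations they coincide.
    rw [measure_eq_zero_iff_ae_notMem]
    filter_upwards [hgen] with z hz ⟨hzk, hzk'⟩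
    have e := hz.dyadicIndex_eq hr hzk
    have e' := hz.dyadicIndex_eq hr hzk'
    rcases lt_trichotomy n n' with hnn | rfl | hnn
    · refine hlt' n hnn ?_
      rw [dyadicIndex_eq_of_le hnn.le (hxk'.trans e'.symm), e]
      exact hPk
    · exact hne (by rw [← e, ← e'])
    · refine hlt n' hnn ?_
      rw [dyadicIndex_eq_of_le hnn.le (hxk.trans e.symm), e']
      exact hPk'
  · have hh' : AEMeasurable ((cube x₀ r).indicator h) := hh.indicator (measurableSet_cube _ _)
    have htop : ∫⁻ x, (cube x₀ r).indicator h x ≠ ∞ := by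
      rw [lintegral_indicator (measurableSet_cube _ _)]
      exact (ha.trans_lt (ENNReal.mul_lt_top ha_top.lt_top
        (volume_cube_ne_top x₀ hr.le).lt_top)).ne
    filter_upwards [hgen, ae_tendsto_lintegral_cube_div hh' htop] with x hx hdiff hxQ hxT
    -- Off the selected cubes no dyadic cube around `x` has average above `a`, so the
    -- differentiation theorem bounds `h x`.
    have hnP : ∀ n, ¬ P n (dyadicIndex x₀ r n x) := by
      by_contra hcon
      push Not at hcon
      classical
      have hmem : (Nat.find hcon, dyadicIndex x₀ r (Nat.find hcon) x) ∈ I :=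
        ⟨x, hxQ, hx, rfl, Nat.find_spec hcon, fun m hm => Nat.find_min hcon hm⟩
      exact hxT (mem_iUnion₂.2 ⟨_, mem_image_of_mem F hmem, mem_dyadicCube_dyadicIndex x₀ hr _ x⟩)
    have hlim := hdiff (fun n => dyadicCenter x₀ r n (dyadicIndex x₀ r n x)) (fun n => r / 2 ^ n)
      (fun n => by positivity) (tendsto_const_nhds.div_atTop
        (tendsto_pow_atTop_atTop_of_one_lt (by norm_num)))
      (fun n => mem_dyadicCube_dyadicIndex x₀ hr n x)
    rw [indicator_of_mem hxQ] at hlim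
    refine le_of_tendsto' hlim fun n => ?_
    have hsub : dyadicCube x₀ r n (dyadicIndex x₀ r n x) ⊆ cube x₀ r :=
      hx.dyadicCube_subset hr hxQ n
    have hr2 : 0 < r / 2 ^ n := by positivity
    refine ENNReal.div_le_of_le_mul ?_
    rw [setLIntegral_congr_fun (measurableSet_cube _ _)
      (g := h) fun y hy => indicator_of_mem (hsub hy) h]
    exact not_lt.1 (hnP n)

theorem tsum_setLIntegral_cube_le {T : Set (E d × ℝ)} (hT : T.Countable)
    (hd : T.Pairwise (Function.onFun (AEDisjoint volume) fun q => cube q.1 q.2)) {Q : Set (E d)}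
    (hQ : ∀ q ∈ T, cube q.1 q.2 ⊆ Q) (h : E d → ℝ≥0∞) :
    ∑' q : T, ∫⁻ x in cube q.1.1 q.1.2, h x ≤ ∫⁻ x in Q, h x := by
  rw [← lintegral_biUnion₀ hT (s := fun q => cube q.1 q.2)
    (fun q _ => (measurableSet_cube _ _).nullMeasurableSet) hd]
  exact lintegral_mono_set (iUnion₂_subset hQ)

theorem tsum_measure_cube_eq {μ : Measure (E d)} (hμ : μ ≪ volume) {T : Set (E d × ℝ)}
    (hT : T.Countable)
    (hd : T.Pairwise (Function.onFun (AEDisjoint volume) fun q => cube q.1 q.2)) :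
    ∑' q : T, μ (cube q.1.1 q.1.2) = μ (⋃ q ∈ T, cube q.1 q.2) :=
  (measure_biUnion₀ hT (fun _ hq _ hq' hne => hμ (hd hq hq' hne))
    fun _ _ => (measurableSet_cube _ _).nullMeasurableSet).symm

/-- If small portions of all small subcubes carry at most a proportion `b` of the mass, then the
mass of a set decays geometrically with its volume. -/
theorem measure_le_pow_mul_of_forall_subcube {μ : Measure (E d)} (hμ : μ ≪ volume) {x₀ : E d}
    {r : ℝ} (hr : 0 < r) {v a b : ℝ≥0∞} (hv : v ≤ volume (cube x₀ r)) (ha0 : a ≠ 0) (ha1 : a < 1)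
    (H : ∀ (y : E d) (l : ℝ), 0 < l → cube y l ⊆ cube x₀ r → volume (cube y l) ≤ v →
      ∀ S, MeasurableSet S → S ⊆ cube y l → volume S ≤ a * volume (cube y l) →
        μ S ≤ b * μ (cube y l)) (k : ℕ) :
    ∀ S, MeasurableSet S → S ⊆ cube x₀ r → (2 ^ d / a) ^ k * volume S ≤ v →
      μ S ≤ b ^ k * μ (cube x₀ r) := by
  have ha_top : a ≠ ∞ := ha1.ne_top
  have h2 : (1 : ℝ≥0∞) ≤ 2 ^ d := one_le_pow₀ (by norm_num)
  have h2' : (2 : ℝ≥0∞) ^ d ≠ ∞ := by finiteness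
  have h20 : (2 : ℝ≥0∞) ^ d ≠ 0 := by positivity
  set g : ℝ≥0∞ := 2 ^ d / a with hg
  have hg1 : 1 ≤ g := by
    rw [hg, ENNReal.le_div_iff_mul_le (Or.inl ha0) (Or.inl ha_top), one_mul]
    exact ha1.le.trans h2
  have hginv : a / 2 ^ d = g⁻¹ := (ENNReal.inv_div (Or.inl ha_top) (Or.inl ha0)).symm
  have hg0 : g ≠ 0 := (zero_lt_one.trans_le hg1).ne'
  have hgt : g ≠ ∞ := ENNReal.div_ne_top h2' ha0
  induction k with
  | zero => intro S _ hSQ _; simpa using measure_mono hSQ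
  | succ k ih =>
    intro S hS hSQ hSv
    have hgS : g * volume S ≤ v := by
      refine le_trans ?_ hSv
      gcongr
      exact le_self_pow₀ hg1 (Nat.succ_ne_zero k)
    -- The height a / 2^d makes the upper bound for the density of `S` in a selected cube equal to
    -- `a`, as `H` requires; the lower bound is g⁻¹.
    have hav : ∫⁻ x in cube x₀ r, S.indicator (fun _ => (1 : ℝ≥0∞)) x
        ≤ (a / 2 ^ d) * volume (cube x₀ r) := by
      rw [lintegral_indicator_const hS, one_mul, hginv,
        ← ENNReal.mul_le_iff_le_inv hg0 hgt]
      exact (mul_le_mul_right (Measure.restrict_apply_le _ _) _).trans (hgS.trans hv)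
    obtain ⟨T, hTc, hT, hTd, hTae⟩ := exists_calderonZygmund_cubes x₀ hr
      ((measurable_const.indicator hS).aemeasurable) (ENNReal.div_ne_top ha_top h20) hav
    have hmeas (q : E d × ℝ) : ∫⁻ x in cube q.1 q.2, S.indicator (fun _ => (1 : ℝ≥0∞)) x
        = volume (S ∩ cube q.1 q.2) := by
      rw [lintegral_indicator_const hS, one_mul, Measure.restrict_apply hS]
    set F : Set (E d) := ⋃ q ∈ T, cube q.1 q.2 with hF
    have hFm : MeasurableSet F := MeasurableSet.biUnion hTc fun q _ => measurableSet_cube _ _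
    have hFQ : F ⊆ cube x₀ r := iUnion₂_subset fun q hq => (hT q hq).2.1
    have hq_le (q) (hq : q ∈ T) : volume (cube q.1 q.2) ≤ g * volume (S ∩ cube q.1 q.2) := by
      have := (hT q hq).2.2.1.le
      rwa [hmeas, hginv, ENNReal.inv_mul_le_iff hg0 hgt] at this
    have hFvol : volume F ≤ g * volume S := by
      rw [hF, ← tsum_measure_cube_eq Measure.AbsolutelyContinuous.rfl hTc hTd]
      calc ∑' q : T, volume (cube q.1.1 q.1.2)
          ≤ ∑' q : T, g * volume (S ∩ cube q.1.1 q.1.2) :=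
            ENNReal.tsum_le_tsum fun q => hq_le q q.2
        _ = g * ∑' q : T, ∫⁻ x in cube q.1.1 q.1.2, S.indicator (fun _ => (1 : ℝ≥0∞)) x := by
            rw [ENNReal.tsum_mul_left]; simp only [hmeas]
        _ ≤ g * ∫⁻ x in cube x₀ r, S.indicator (fun _ => (1 : ℝ≥0∞)) x := by
            gcongr
            exact tsum_setLIntegral_cube_le hTc hTd (fun q hq => (hT q hq).2.1) _
        _ ≤ g * volume S := by
            gcongr
            rw [lintegral_indicator_const hS, one_mul]
            exact Measure.restrict_apply_le _ _
    have hFμ : μ F ≤ b ^ k * μ (cube x₀ r) := by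
      refine ih F hFm hFQ (le_trans ?_ hSv)
      rw [pow_succ, mul_assoc]
      gcongr
    -- Off the selected cubes the indicator is at most a / 2^d < 1 almost everywhere, hence 0.
    have hSF : μ S ≤ μ (S ∩ F) := by
      refine measure_mono_ae (hμ.ae_le ?_)
      filter_upwards [hTae] with x hx hxS
      refine ⟨hxS, by_contra fun hxF => ?_⟩
      have := hx (hSQ hxS) hxF
      rw [indicator_of_mem hxS] at this
      refine absurd this (not_le.2 ?_)
      exact (ENNReal.div_le_of_le_mul (le_mul_of_one_le_right' h2)).trans_lt ha1
    calc μ S ≤ μ (S ∩ F) := hSF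
      _ = μ (⋃ q ∈ T, S ∩ cube q.1 q.2) := by rw [hF, inter_iUnion₂]
      _ ≤ ∑' q : T, μ (S ∩ cube q.1.1 q.1.2) := measure_biUnion_le _ hTc _
      _ ≤ ∑' q : T, b * μ (cube q.1.1 q.1.2) := by
          refine ENNReal.tsum_le_tsum fun q => ?_
          obtain ⟨hq0, hqQ, hq1, hq2⟩ := hT q q.2
          refine H _ _ hq0 hqQ ?_ _ (hS.inter (measurableSet_cube _ _)) inter_subset_right ?_
          -- A selected cube has volume at most `g * volume S ≤ v`: the smallness of `S` forces the
          -- cubes to be small enough for `H`.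
          · refine (hq_le q q.2).trans (le_trans ?_ hgS)
            gcongr
            exact inter_subset_left
          · rwa [hmeas, ENNReal.mul_div_cancel h20 h2'] at hq2
      _ = b * μ F := by rw [ENNReal.tsum_mul_left, tsum_measure_cube_eq hμ hTc hTd]
      _ ≤ b * (b ^ k * μ (cube x₀ r)) := by gcongr
      _ = _ := by ring

/-! ### Lower oscillation and the John–Nirenberg inequality -/

/-- An essential infimum -∞ would make the oscillation identically ∞, against the finite integral;
+∞ is impossible for a real-valued function on a set of positive measure. This allows real
arithmetic with the infimum. -/
theorem exists_essInf_eq_coe {f : E d → ℝ} {Q : Set (E d)}  (hQ : volume Q ≠ 0) (hf : ∫⁻ x in Q, lowerOsc f Q x ≠ ∞) :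
    ∃ m : ℝ, (∀ x, lowerOsc f Q x = ENNReal.ofReal (f x - m)) ∧
      (∀ᵐ x ∂volume.restrict Q, m ≤ f x) ∧
      ∀ c : ℝ, (∀ᵐ x ∂volume.restrict Q, c ≤ f x) → c ≤ m := by
  have hne : NeBot (ae (volume.restrict Q)) := by
    rw [ae_neBot, Ne, Measure.restrict_eq_zero]; exact hQ
  have hle : ∀ᵐ x ∂volume.restrict Q,
      essInf (fun y => (f y : EReal)) (volume.restrict Q) ≤ (f x : EReal) := ae_essInf_le
  have hgreat (c : ℝ) (hc : ∀ᵐ x ∂volume.restrict Q, c ≤ f x) :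
      (c : EReal) ≤ essInf (fun y => (f y : EReal)) (volume.restrict Q) := by
    refine le_essInf_of_ae_le _ ?_
    filter_upwards [hc] with x hx
    exact EReal.coe_le_coe_iff.2 hx
  rcases hm : essInf (fun y => (f y : EReal)) (volume.restrict Q) with _ | _ | m
  · exfalso
    refine hf ?_
    have : ∀ x, lowerOsc f Q x = ∞ := fun x => by
      rw [lowerOsc, hm]
      exact EReal.toENNReal_top
    simp [this, hQ]
  · exfalso
    rw [hm] at hle
    obtain ⟨x, hx⟩ := hle.exists
    exact absurd hx (not_le.2 (EReal.coe_lt_top _))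
  · refine ⟨m, fun x => ?_, ?_, fun c hc => ?_⟩
    · rw [lowerOsc, hm]
      exact EReal.toENNReal_of_ne_top (EReal.coe_ne_top (f x - m))
    · rw [hm] at hle
      filter_upwards [hle] with x hx
      exact EReal.coe_le_coe_iff.1 hx
    · have := hgreat c hc
      rw [hm] at this
      exact EReal.coe_le_coe_iff.1 this

/-- **John–Nirenberg inequality** for functions of bounded lower oscillation on the subcubes of a
cube. -/
theorem volume_lowerOsc_gt_le {f : E d → ℝ} (hf : AEMeasurable f) {Q : Set (E d)} {L : ℝ≥0∞}
    (hL0 : L ≠ 0) (hL : L ≠ ∞)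
    (H : ∀ (y : E d) (l : ℝ), 0 < l → cube y l ⊆ Q →
      ∫⁻ x in cube y l, lowerOsc f (cube y l) x ≤ L * volume (cube y l)) (k : ℕ) :
    ∀ (y : E d) (l : ℝ), 0 < l → cube y l ⊆ Q →
      volume {x ∈ cube y l | k * (2 ^ (d + 1) * L) < lowerOsc f (cube y l) x}
        ≤ (2⁻¹) ^ k * volume (cube y l) := by
  have hfin (y : E d) (l : ℝ) (hl : 0 < l) (hlQ : cube y l ⊆ Q) :
      ∫⁻ x in cube y l, lowerOsc f (cube y l) x ≠ ∞ :=
    ((H y l hl hlQ).trans_lt (ENNReal.mul_lt_top hL.lt_top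
      (volume_cube_ne_top y hl.le).lt_top)).ne
  induction k with
  | zero => intro y l _ _; simpa using measure_mono (sep_subset _ _)
  | succ k ih =>
    intro y l hl hlQ
    obtain ⟨m, hm, -, -⟩ := exists_essInf_eq_coe
      (volume_cube_ne_zero y hl) (hfin y l hl hlQ)
    set h := lowerOsc f (cube y l) with hh
    have hhm : AEMeasurable h := by
      have : h = fun x => ENNReal.ofReal (f x - m) := funext hm
      rw [this]; fun_prop
    have h2L : 2 * L ≠ ∞ := by finiteness
    have h2L0 : 2 * L ≠ 0 := by simp [hL0]
    -- The stopping height is 2L although the mean is at most L; the spare factor 2 makes the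
    -- selected volume at most half of the cube.
    have hav : ∫⁻ x in cube y l, h x ≤ 2 * L * volume (cube y l) := by
      refine (H y l hl hlQ).trans ?_
      gcongr
      exact le_mul_of_one_le_left' (by norm_num)
    obtain ⟨T, hTc, hT, hTd, hTae⟩ := exists_calderonZygmund_cubes y hl hhm h2L hav
    set b : ℝ≥0∞ := 2 ^ (d + 1) * L with hb
    have hbtop : b ≠ ∞ := by finiteness
    have hbL : 2 ^ d * (2 * L) = b := by rw [hb]; ring
    have hLb : 2 * L ≤ b := by
      rw [← hbL]; exact le_mul_of_one_le_left' (one_le_pow₀ (by norm_num))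
    have hsub (q) (hq : q ∈ T) : {x ∈ cube q.1 q.2 | (k + 1 : ℕ) * b < h x} ⊆
        {x ∈ cube q.1 q.2 | k * b < lowerOsc f (cube q.1 q.2) x} := by
      obtain ⟨hq0, hqQ, -, hq2⟩ := hT q hq
      obtain ⟨m', hm', hm'f, -⟩ := exists_essInf_eq_coe
        (volume_cube_ne_zero q.1 hq0) (hfin q.1 q.2 hq0 (hqQ.trans hlQ))
      -- On a selected cube f - m is at least m' - m almost everywhere and has mean at most 2^d · 2L
      -- = b, so passing to the infimum of the subcube costs one level.
      have hmm : ENNReal.ofReal (m' - m) ≤ b := by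
        have h1 : ENNReal.ofReal (m' - m) * volume (cube q.1 q.2)
            ≤ b * volume (cube q.1 q.2) := by
          rw [← setLIntegral_const, ← hbL]
          refine le_trans (lintegral_mono_ae ?_) hq2
          filter_upwards [hm'f] with x hx
          rw [hm]
          exact ENNReal.ofReal_le_ofReal (by linarith)
        exact (ENNReal.mul_le_mul_iff_left (volume_cube_ne_zero q.1 hq0)
          (volume_cube_ne_top q.1 hq0.le)).1 h1
      rintro x ⟨hxq, hx⟩
      refine ⟨hxq, ?_⟩
      rw [hm']
      rw [hm] at hx
      have h3 : ENNReal.ofReal (f x - m) ≤ ENNReal.ofReal (f x - m') + b := by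
        calc ENNReal.ofReal (f x - m) = ENNReal.ofReal ((f x - m') + (m' - m)) := by ring_nf
          _ ≤ ENNReal.ofReal (f x - m') + ENNReal.ofReal (m' - m) := ENNReal.ofReal_add_le
          _ ≤ _ := by gcongr
      have h4 := hx.trans_le h3
      rw [Nat.cast_succ, add_mul, one_mul] at h4
      exact lt_of_add_lt_add_right h4
    have hcover : volume {x ∈ cube y l | (k + 1 : ℕ) * b < h x} ≤
        volume (⋃ q ∈ T, {x ∈ cube q.1 q.2 | (k + 1 : ℕ) * b < h x}) := by
      refine measure_mono_ae ?_
      filter_upwards [hTae] with x hx ⟨hxQ, hxh⟩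
      by_cases hxT : x ∈ ⋃ q ∈ T, cube q.1 q.2
      · obtain ⟨q, hq, hxq⟩ := mem_iUnion₂.1 hxT
        exact mem_iUnion₂.2 ⟨q, hq, hxq, hxh⟩
      · exfalso
        refine absurd ((hx hxQ hxT).trans hLb) (not_le.2 (lt_of_le_of_lt ?_ hxh))
        exact le_mul_of_one_le_left' (by exact_mod_cast Nat.succ_le_succ (Nat.zero_le k))
    calc _ ≤ _ := hcover
      _ ≤ ∑' q : T, volume {x ∈ cube q.1.1 q.1.2 | (k + 1 : ℕ) * b < h x} :=
          measure_biUnion_le _ hTc _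
      _ ≤ ∑' q : T, (2⁻¹) ^ k * ((2 * L)⁻¹ * ∫⁻ x in cube q.1.1 q.1.2, h x) := by
          refine ENNReal.tsum_le_tsum fun q => ?_
          obtain ⟨hq0, hqQ, hq1, -⟩ := hT q q.2
          refine (measure_mono (hsub q q.2)).trans ((ih _ _ hq0 (hqQ.trans hlQ)).trans ?_)
          gcongr
          rw [← ENNReal.mul_le_iff_le_inv h2L0 h2L]
          exact hq1.le
      _ = (2⁻¹) ^ k * ((2 * L)⁻¹ * ∑' q : T, ∫⁻ x in cube q.1.1 q.1.2, h x) := by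
          rw [ENNReal.tsum_mul_left, ENNReal.tsum_mul_left]
      _ ≤ (2⁻¹) ^ k * ((2 * L)⁻¹ * (L * volume (cube y l))) := by
          gcongr
          exact (tsum_setLIntegral_cube_le hTc hTd (fun q hq => (hT q hq).2.1) _).trans
            (H y l hl hlQ)
      _ = (2⁻¹) ^ (k + 1) * volume (cube y l) := by
          rw [ENNReal.mul_inv (by simp) (by simp), pow_succ, mul_assoc, ← mul_assoc L⁻¹,
            ENNReal.inv_mul_cancel hL0 hL, one_mul, mul_assoc]

/-! ### Muckenhoupt weights -/

theorem weightedMeasure_eq_withDensity (ω : E d → ℝ) {S : Set (E d)} (hS : MeasurableSet S) :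
    weightedMeasure ω S = volume.withDensity (fun x => ENNReal.ofReal (ω x)) S :=
  (withDensity_apply _ hS).symm

theorem weightedMeasure_mono (ω : E d → ℝ) {S T : Set (E d)} (h : S ⊆ T) :
    weightedMeasure ω S ≤ weightedMeasure ω T := lintegral_mono_set h

theorem weightedMeasure_ne_zero {ω : E d → ℝ} (hω : ∀ᵐ x, 0 < ω x) (hm : AEMeasurable ω)
    {S : Set (E d)} (hS : volume S ≠ 0) : weightedMeasure ω S ≠ 0 := by
  intro h
  rw [weightedMeasure, lintegral_eq_zero_iff' hm.ennreal_ofReal.restrict] at h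
  refine hS (Measure.restrict_eq_zero.1 (ae_eq_bot.1 (eventually_false_iff_eq_bot.1 ?_)))
  filter_upwards [h, ae_restrict_of_ae hω] with x hx hx'
  simp only [Pi.zero_apply, ENNReal.ofReal_eq_zero] at hx
  linarith

theorem weightedMeasure_ne_top {ω : E d → ℝ} (hω : LocallyIntegrable ω) {S K : Set (E d)}
    (hK : IsCompact K) (hSK : S ⊆ K) : weightedMeasure ω S ≠ ∞ := by
  have h1 : IntegrableOn ω S := (hω.integrableOn_isCompact hK).mono_set hSK
  refine (lt_of_le_of_lt (lintegral_mono fun x => ?_) h1.2).ne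
  exact Real.ofReal_le_enorm (ω x)

/-- **Hölder's inequality** against a Muckenhoupt weight. -/
theorem lintegral_mul_weightedMeasure_rpow_le {p : ℝ} (hp : 1 ≤ p) {ω : E d → ℝ}
    (hω : ∀ᵐ x, 0 < ω x) (hm : AEMeasurable ω) {Q B : Set (E d)} (hB0 : volume B ≠ 0)
    (hB : volume B ≠ ∞) (hQB : Q ⊆ B) {g : E d → ℝ≥0∞} (hg : AEMeasurable g) :
    (∫⁻ x in Q, g x) * weightedMeasure ω B ^ (1 / p) ≤
      (∫⁻ x in Q, g x ^ p * ENNReal.ofReal (ω x)) ^ (1 / p) *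
        (volume B * muckenhoupt p ω B) := by
  rcases hp.eq_or_lt with rfl | hp1
  · simp only [muckenhoupt, if_true, div_one, ENNReal.rpow_one]
    rw [setLAverage_eq, ← mul_assoc (volume B), ENNReal.mul_div_cancel hB0 hB]
    change _ ≤ _ * (weightedMeasure ω B * _)
    set e := essInf (fun x => ENNReal.ofReal (ω x)) (volume.restrict B)
    have hle : ∀ᵐ x ∂volume.restrict B, e ≤ ENNReal.ofReal (ω x) := ae_essInf_le
    have hle' : ∀ᵐ x ∂volume.restrict Q, e ≤ ENNReal.ofReal (ω x) :=
      ae_restrict_of_ae_restrict_of_subset hQB hle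
    have he : e ≠ ∞ := by
      have : NeBot (ae (volume.restrict B)) := by
        rw [ae_neBot, Ne, Measure.restrict_eq_zero]; exact hB0
      obtain ⟨x, hx⟩ := hle.exists
      exact (hx.trans_lt ENNReal.ofReal_lt_top).ne
    -- If `e = 0` the factor `e⁻¹` is ∞, and the degenerate products 0 · ∞ have to be settled
    -- separately.
    by_cases he0 : e = 0
    · rw [he0, ENNReal.inv_zero]
      by_cases hw : weightedMeasure ω B = 0
      · simp [hw]
      rw [ENNReal.mul_top hw]
      by_cases hi : ∫⁻ x in Q, g x * ENNReal.ofReal (ω x) = 0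
      · have : ∫⁻ x in Q, g x = 0 := by
          have hgw : AEMeasurable (fun x => g x * ENNReal.ofReal (ω x)) (volume.restrict Q) :=
            (hg.mul hm.ennreal_ofReal).restrict
          rw [lintegral_eq_zero_iff' hgw] at hi
          rw [lintegral_eq_zero_iff' hg.restrict]
          filter_upwards [hi, ae_restrict_of_ae hω] with x hx hx'
          simpa [hx'.not_ge] using hx
        simp [this]
      · rw [ENNReal.mul_top hi]; exact le_top
    · rw [mul_comm (weightedMeasure ω B), ← mul_assoc]
      gcongr
      rw [mul_comm, ← ENNReal.mul_le_iff_le_inv he0 he, ← lintegral_const_mul'' _ hg.restrict]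
      refine lintegral_mono_ae ?_
      filter_upwards [hle'] with x hx
      rw [mul_comm]
      gcongr
  · have hp0 : 0 < p := by linarith
    have hpq : p.HolderConjugate (p / (p - 1)) := Real.HolderConjugate.conjExponent hp1
    set q := p / (p - 1) with hq
    have hq0 : 0 < q := hpq.symm.pos
    simp only [muckenhoupt, if_neg hp1.ne']
    rw [setLAverage_eq, setLAverage_eq]
    change _ ≤ _ * (volume B * ((weightedMeasure ω B / volume B) ^ (1 / p) * _))
    set σ := ∫⁻ x in B, ENNReal.ofReal (ω x) ^ (-(q / p))
    -- Since 1/p + 1/q = 1, the factor |B| exactly removes the two normalizations of the averages.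
    have e1 : volume B * ((weightedMeasure ω B / volume B) ^ (1 / p) *
        (σ / volume B) ^ (1 / q)) = weightedMeasure ω B ^ (1 / p) * σ ^ (1 / q) := by
      rw [ENNReal.div_rpow_of_nonneg _ _ (by positivity),
        ENNReal.div_rpow_of_nonneg _ _ (by positivity),
        div_eq_mul_inv (weightedMeasure ω B ^ (1 / p)), div_eq_mul_inv (σ ^ (1 / q))]
      have h3 : volume B = volume B ^ (1 / p) * volume B ^ (1 / q) := by
        rw [← ENNReal.rpow_add _ _ hB0 hB]
        simp [hpq.inv_add_inv_eq_one]
      have h4 : volume B ^ (1 / p) * (volume B ^ (1 / p))⁻¹ = 1 :=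
        ENNReal.mul_inv_cancel (by simp [hB0, hB]) (by
          exact ENNReal.rpow_ne_top_of_nonneg (by positivity) hB)
      have h5 : volume B ^ (1 / q) * (volume B ^ (1 / q))⁻¹ = 1 :=
        ENNReal.mul_inv_cancel (by simp [hB0, hB]) (by
          exact ENNReal.rpow_ne_top_of_nonneg (by positivity) hB)
      nth_rw 1 [h3]
      calc _ = weightedMeasure ω B ^ (1 / p) * σ ^ (1 / q) *
            (volume B ^ (1 / p) * (volume B ^ (1 / p))⁻¹) *
            (volume B ^ (1 / q) * (volume B ^ (1 / q))⁻¹) := by ring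
        _ = _ := by rw [h4, h5, mul_one, mul_one]
    rw [e1, mul_comm (weightedMeasure ω B ^ (1 / p)), ← mul_assoc]
    gcongr
    have hw := hm.ennreal_ofReal
    have e2 : ∫⁻ x in Q, g x = ∫⁻ x in Q, ((fun x => g x * ENNReal.ofReal (ω x) ^ (1 / p)) *
        fun x => ENNReal.ofReal (ω x) ^ (-(1 / p))) x := by
      -- Splitting 1 = ω^(1/p) ω^(-1/p) uses that ω is positive almost everywhere.
      refine lintegral_congr_ae ?_
      filter_upwards [ae_restrict_of_ae hω] with x hx
      have h0 : ENNReal.ofReal (ω x) ≠ 0 := by simpa using hx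
      rw [Pi.mul_apply, mul_assoc, ← ENNReal.rpow_add _ _ h0 ENNReal.ofReal_ne_top]
      simp
    rw [e2]
    refine (ENNReal.lintegral_mul_le_Lp_mul_Lq _ hpq
      (hg.mul (hw.pow_const _)).restrict (hw.pow_const _).restrict).trans ?_
    gcongr ?_ ^ _ * ?_ ^ _
    · refine lintegral_mono fun x => ?_
      change (g x * ENNReal.ofReal (ω x) ^ (1 / p)) ^ p ≤ _
      rw [ENNReal.mul_rpow_of_nonneg _ _ hp0.le, ← ENNReal.rpow_mul]
      simp [hp0.ne']
    · refine (lintegral_mono fun x => ?_).trans (lintegral_mono_set hQB)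
      simp only
      rw [← ENNReal.rpow_mul]
      apply le_of_eq
      congr 1
      ring

/-- Hölder's inequality with g = 1 and Q = B, divided by |B| ω(B)^(1/p). -/
theorem one_le_muckenhoupt {p : ℝ} (hp : 1 ≤ p) {ω : E d → ℝ} (hω : ∀ᵐ x, 0 < ω x)
    (hm : LocallyIntegrable ω) (x₀ : E d) {r : ℝ} (hr : 0 < r) :
    1 ≤ muckenhoupt p ω (Metric.ball x₀ r) := by
  have hB0 : volume (Metric.ball x₀ r) ≠ 0 := (Metric.measure_ball_pos _ _ hr).ne'
  have hB : volume (Metric.ball x₀ r) ≠ ∞ := measure_ball_lt_top.ne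
  have hme := hm.aestronglyMeasurable.aemeasurable
  have h := lintegral_mul_weightedMeasure_rpow_le hp hω hme hB0 hB
    (Subset.refl _) (g := fun _ => 1) aemeasurable_const
  simp only [lintegral_const, Measure.restrict_apply_univ, one_mul, ENNReal.one_rpow] at h
  change _ ≤ weightedMeasure ω _ ^ (1 / p) * _ at h
  have hw0 := weightedMeasure_ne_zero hω hme hB0
  have hw : weightedMeasure ω (Metric.ball x₀ r) ≠ ∞ :=
    weightedMeasure_ne_top hm (isCompact_closedBall x₀ r) Metric.ball_subset_closedBall
  have hp0 : 0 < p := by linarith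
  rw [mul_comm, ENNReal.mul_le_mul_iff_right (by simp [hw0, hw])
    (ENNReal.rpow_ne_top_of_nonneg (by positivity) hw)] at h
  nth_rw 1 [← mul_one (volume (Metric.ball x₀ r))] at h
  exact (ENNReal.mul_le_mul_iff_right hB0 hB).1 h

theorem muckenhoupt_le_apConst {p θ : ℝ} {ρ : E d → ℝ} (hρ : ∀ x, 0 < ρ x) (ω : E d → ℝ)
    (x₀ : E d) {r : ℝ} (hr : 0 < r) :
    muckenhoupt p ω (Metric.ball x₀ r) ≤
      ENNReal.ofReal ((1 + r / ρ x₀) ^ θ) * apConst p ρ θ ω := by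
  have h1 : 0 < 1 + r / ρ x₀ := by have := hρ x₀; positivity
  have h2 : ENNReal.ofReal ((1 + r / ρ x₀) ^ (-θ)) * muckenhoupt p ω (Metric.ball x₀ r) ≤
      apConst p ρ θ ω := le_iSup_of_le x₀ (le_iSup_of_le r (le_iSup_of_le hr le_rfl))
  rw [Real.rpow_neg h1.le, ENNReal.ofReal_inv_of_pos (by positivity)] at h2
  exact (ENNReal.inv_mul_le_iff (by simpa using Real.rpow_pos_of_pos h1 θ)
    ENNReal.ofReal_ne_top).1 h2

/-- If ω vanished on a set of positive measure, a large ball would meet that set in positive measure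
and also have ω(B) > 0. There the negative power has infinite integral, or the essential infimum is
0, so the Muckenhoupt quantity is infinite. -/
theorem MemAp.ae_pos {p θ : ℝ} {ρ : E d → ℝ} (hp : 1 ≤ p) (hρ : ∀ x, 0 < ρ x) {ω : E d → ℝ}
    (h : MemAp p ρ θ ω) : ∀ᵐ x, 0 < ω x := by
  have hm := h.locallyIntegrable.aestronglyMeasurable.aemeasurable
  have hw := hm.ennreal_ofReal
  by_contra hcon
  have hfreq : ∃ᶠ x in ae volume, ω x = 0 := by
    refine (not_eventually.1 hcon).mono fun x hx => ?_
    exact le_antisymm (not_lt.1 hx) (h.nonneg x)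
  have hball : ∀ᶠ n : ℕ in atTop, muckenhoupt p ω (Metric.ball 0 n) = ∞ := by
    have hZ : ∃ n : ℕ, ∃ᶠ x in ae (volume.restrict (Metric.ball (0 : E d) n)), ω x = 0 := by
      by_contra hn
      simp only [not_exists, not_frequently] at hn
      have : ∀ᵐ x ∂volume.restrict (⋃ n : ℕ, Metric.ball (0 : E d) n), ¬ ω x = 0 :=
        (ae_restrict_iUnion_iff _ _).2 hn
      rw [Metric.iUnion_ball_nat, Measure.restrict_univ] at this
      exact hfreq this
    have hP : ∃ n : ℕ, weightedMeasure ω (Metric.ball (0 : E d) n) ≠ 0 := by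
      by_contra hn
      simp only [not_exists, not_not] at hn
      refine h.ne_zero ?_
      have : ∀ᵐ x ∂volume.restrict (⋃ n : ℕ, Metric.ball (0 : E d) n), ω x = 0 := by
        refine (ae_restrict_iUnion_iff _ _).2 fun n => ?_
        have := hn n
        rw [weightedMeasure, lintegral_eq_zero_iff' hw.restrict] at this
        filter_upwards [this] with x hx
        exact le_antisymm (by simpa using hx) (h.nonneg x)
      rwa [Metric.iUnion_ball_nat, Measure.restrict_univ] at this
    obtain ⟨n₁, hn₁⟩ := hZ
    obtain ⟨n₂, hn₂⟩ := hP
    filter_upwards [eventually_ge_atTop n₁, eventually_ge_atTop n₂, eventually_gt_atTop 0]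
      with n h1 h2 h3
    have hB : volume (Metric.ball (0 : E d) n) ≠ ∞ := measure_ball_lt_top.ne
    have hpos : weightedMeasure ω (Metric.ball (0 : E d) n) ≠ 0 := fun h0 => hn₂
      (le_antisymm ((weightedMeasure_mono ω (Metric.ball_subset_ball
        (by exact_mod_cast h2))).trans h0.le) zero_le)
    have hzero : ∃ᶠ x in ae (volume.restrict (Metric.ball (0 : E d) n)), ω x = 0 :=
      hn₁.filter_mono (ae_mono (Measure.restrict_mono (Metric.ball_subset_ball
        (by exact_mod_cast h1)) le_rfl))
    have havg : (⨍⁻ x in Metric.ball (0 : E d) n, ENNReal.ofReal (ω x) ∂volume) ≠ 0 := by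
      rw [setLAverage_eq]
      exact (ENNReal.div_pos hpos hB).ne'
    rw [muckenhoupt]
    split_ifs with hp1
    · have : essInf (fun x => ENNReal.ofReal (ω x))
          (volume.restrict (Metric.ball (0 : E d) n)) = 0 := by
        obtain ⟨x, hx, hx'⟩ := (hzero.and_eventually (ae_essInf_le
          (f := fun x => ENNReal.ofReal (ω x)))).exists
        simpa [hx] using hx'
      rw [this, ENNReal.inv_zero, ENNReal.mul_top havg]
    · have hp1' : 1 < p := lt_of_le_of_ne hp (Ne.symm hp1)
      have hp0 : 0 < p - 1 := by linarith
      have hpp : 0 < p := by linarith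
      have : (⨍⁻ x in Metric.ball (0 : E d) n,
          ENNReal.ofReal (ω x) ^ (-((p / (p - 1)) / p)) ∂volume) = ∞ := by
        rw [setLAverage_eq, ENNReal.div_eq_top]
        refine Or.inr ⟨?_, hB⟩
        by_contra hne
        refine hzero ?_
        filter_upwards [ae_lt_top' (hw.pow_const _).restrict hne] with x hx hx0
        have hneg : -((p / (p - 1)) / p) < 0 := by
          have : 0 < (p / (p - 1)) / p := by positivity
          linarith
        simp [hx0, ENNReal.zero_rpow_of_neg hneg] at hx
      rw [this, ENNReal.top_rpow_of_pos (by positivity), ENNReal.mul_top]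
      exact (ENNReal.rpow_pos (pos_iff_ne_zero.2 havg) (by
        rw [setLAverage_eq]
        exact ENNReal.div_ne_top (weightedMeasure_ne_top h.locallyIntegrable
          (isCompact_closedBall 0 (n : ℝ)) Metric.ball_subset_closedBall)
          (Metric.measure_ball_pos _ _ (by exact_mod_cast h3)).ne')).ne'
  obtain ⟨n, hn, hn0⟩ := (hball.and (eventually_gt_atTop 0)).exists
  have hle := muckenhoupt_le_apConst (p := p) (θ := θ) hρ ω 0 (r := n) (by exact_mod_cast hn0)
  rw [hn, top_le_iff] at hle
  exact ENNReal.mul_ne_top ENNReal.ofReal_ne_top h.apConst_lt_top.ne hle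

/-! ### Part (2): from the weighted condition to BLO -/

theorem aemeasurable_lowerOsc {f : E d → ℝ} (hf : AEMeasurable f) (Q : Set (E d)) :
    AEMeasurable (lowerOsc f Q) := by
  unfold lowerOsc
  rcases essInf (fun y => (f y : EReal)) (volume.restrict Q) with _ | _ | m
  · have : (fun x => ((f x : EReal) - (⊥ : EReal)).toENNReal) = fun _ => ∞ := by
      funext x; exact EReal.toENNReal_top
    change AEMeasurable (fun x => ((f x : EReal) - (⊥ : EReal)).toENNReal)
    rw [this]; exact aemeasurable_const
  · have : (fun x => ((f x : EReal) - (⊤ : EReal)).toENNReal) = fun _ => 0 := by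
      funext x; simp
    change AEMeasurable (fun x => ((f x : EReal) - (⊤ : EReal)).toENNReal)
    rw [this]; exact aemeasurable_const
  · have : (fun x => ((f x : EReal) - (m : EReal)).toENNReal) =
        fun x => ENNReal.ofReal (f x - m) := by
      funext x; exact EReal.toENNReal_of_ne_top (EReal.coe_ne_top (f x - m))
    change AEMeasurable (fun x => ((f x : EReal) - (m : EReal)).toENNReal)
    rw [this]; fun_prop

theorem integrableOn_of_lintegral_lowerOsc_ne_top {f : E d → ℝ} (hf : AEMeasurable f)
    {Q : Set (E d)} (hQ : volume Q ≠ 0) (hQ' : volume Q ≠ ∞)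
    (h : ∫⁻ x in Q, lowerOsc f Q x ≠ ∞) : IntegrableOn f Q := by
  obtain ⟨m, hm, hle, -⟩ := exists_essInf_eq_coe hQ h
  have h1 : IntegrableOn (fun x => f x - m) Q := by
    refine ⟨(hf.sub_const m).restrict.aestronglyMeasurable, ?_⟩
    rw [hasFiniteIntegral_iff_ofReal]
    · simp only [hm] at h
      exact h.lt_top
    · filter_upwards [hle] with x hx
      exact sub_nonneg.2 hx
  have h2 : IntegrableOn (fun _ : E d => m) Q := integrableOn_const hQ'
  exact (h1.add h2).congr (Eventually.of_forall fun x => by simp)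

theorem bloNorm_le {f : E d → ℝ} {ρ : E d → ℝ} {θ : ℝ} (hρ : ∀ x, 0 < ρ x) {M : ℝ≥0∞}
    (h : ∀ (x₀ : E d) (r : ℝ), 0 < r → ∫⁻ x in cube x₀ r, lowerOsc f (cube x₀ r) x ≤
      M * ENNReal.ofReal ((1 + r / ρ x₀) ^ θ) * volume (cube x₀ r)) : bloNorm ρ θ f ≤ M := by
  refine iSup_le fun x₀ => iSup_le fun r => iSup_le fun hr => ?_
  have h1 : 0 < 1 + r / ρ x₀ := by have := hρ x₀; positivity
  rw [Real.rpow_neg h1.le, ENNReal.ofReal_inv_of_pos (by positivity),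
    ENNReal.inv_mul_le_iff (by simpa using Real.rpow_pos_of_pos h1 θ) ENNReal.ofReal_ne_top,
    setLAverage_eq]
  refine ENNReal.div_le_of_le_mul ((h x₀ r hr).trans (le_of_eq ?_))
  ring

theorem lintegral_lowerOsc_le {f : E d → ℝ} {ρ : E d → ℝ} {θ : ℝ} (hρ : ∀ x, 0 < ρ x)
    (x₀ : E d) {r : ℝ} (hr : 0 < r) :
    ∫⁻ x in cube x₀ r, lowerOsc f (cube x₀ r) x ≤
      bloNorm ρ θ f * ENNReal.ofReal ((1 + r / ρ x₀) ^ θ) * volume (cube x₀ r) := by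
  have h1 : 0 < 1 + r / ρ x₀ := by have := hρ x₀; positivity
  have h2 : ENNReal.ofReal ((1 + r / ρ x₀) ^ (-θ)) *
      ⨍⁻ x in cube x₀ r, lowerOsc f (cube x₀ r) x ∂volume ≤ bloNorm ρ θ f :=
    le_iSup_of_le x₀ (le_iSup_of_le r (le_iSup_of_le hr le_rfl))
  rw [Real.rpow_neg h1.le, ENNReal.ofReal_inv_of_pos (by positivity),
    ENNReal.inv_mul_le_iff (by simpa using Real.rpow_pos_of_pos h1 θ) ENNReal.ofReal_ne_top,
    setLAverage_eq, ENNReal.div_le_iff (volume_cube_ne_zero _ hr) (volume_cube_ne_top _ hr.le)]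
    at h2
  exact h2.trans (le_of_eq (by ring))

theorem volume_ball_le_cube (x₀ : E d) {r : ℝ} (hr : 0 < r) :
    volume (Metric.ball x₀ (√d * r)) ≤ ENNReal.ofReal ((2 * √d) ^ d) * volume (cube x₀ r) := by
  refine (measure_mono (ball_subset_cube x₀ _)).trans (le_of_eq ?_)
  rw [volume_cube _ (by positivity), volume_cube _ hr.le, ← ENNReal.ofReal_mul (by positivity),
    ← mul_pow]
  congr 2; ring

theorem one_add_mul_div_rpow_le {a r s θ : ℝ} (ha : 1 ≤ a) (hr : 0 ≤ r) (hs : 0 ≤ s) (hθ : 0 ≤ θ) :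
    (1 + a * r / s) ^ θ ≤ a ^ θ * (1 + r / s) ^ θ := by
  rw [← Real.mul_rpow (by linarith) (by positivity)]
  have : 0 ≤ r / s := by positivity
  refine Real.rpow_le_rpow (by positivity) ?_ hθ
  rw [mul_add, mul_div_assoc]
  linarith

theorem one_le_sqrt_natCast (hd : 0 < d) : (1 : ℝ) ≤ √d := by
  rw [Real.one_le_sqrt]
  exact_mod_cast hd

/-- The unweighted integral over a cube in terms of a weighted one. -/
theorem lintegral_mul_weightedMeasure_cube_le (hd : 0 < d) {p θ : ℝ} (hp : 1 ≤ p) (hθ : 0 < θ)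
    {ρ : E d → ℝ} (hρ : ∀ x, 0 < ρ x) {ω : E d → ℝ} (hω : MemAp p ρ θ ω) {g : E d → ℝ≥0∞}
    (hg : AEMeasurable g) (x₀ : E d) {r : ℝ} (hr : 0 < r) :
    (∫⁻ x in cube x₀ r, g x) * weightedMeasure ω (cube x₀ r) ^ (1 / p) ≤
      (∫⁻ x in cube x₀ r, g x ^ p * ENNReal.ofReal (ω x)) ^ (1 / p) *
        (ENNReal.ofReal ((2 * √d) ^ d * √d ^ θ) * ENNReal.ofReal ((1 + r / ρ x₀) ^ θ) *
          apConst p ρ θ ω * volume (cube x₀ r)) := by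
  have hp0 : 0 < p := by linarith
  have hsd := one_le_sqrt_natCast hd
  have hR : 0 < √d * r := by positivity
  have hρ0 := hρ x₀
  -- The class A_p is defined by balls and BLO by cubes: Hölder is applied on the ball of radius √d
  -- r around the cube, at the cost of (2√d)^d for the volume and √d^θ for the larger radius.
  have h := lintegral_mul_weightedMeasure_rpow_le hp (hω.ae_pos hp hρ)
    hω.locallyIntegrable.aestronglyMeasurable.aemeasurable
    (Metric.measure_ball_pos volume x₀ hR).ne' measure_ball_lt_top.ne
    (cube_subset_ball hd x₀ hr) hg
  refine le_trans ?_ (h.trans ?_)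
  · gcongr
    exact weightedMeasure_mono ω (cube_subset_ball hd x₀ hr)
  · refine mul_le_mul_right ?_ _
    calc volume (Metric.ball x₀ (√d * r)) * muckenhoupt p ω (Metric.ball x₀ (√d * r))
        ≤ (ENNReal.ofReal ((2 * √d) ^ d) * volume (cube x₀ r)) *
          (ENNReal.ofReal (√d ^ θ * (1 + r / ρ x₀) ^ θ) * apConst p ρ θ ω) := by
          gcongr
          · exact volume_ball_le_cube x₀ hr
          · refine (muckenhoupt_le_apConst (θ := θ) hρ ω x₀ hR).trans ?_
            gcongr
            exact one_add_mul_div_rpow_le hsd hr.le hρ0.le hθ.le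
      _ = _ := by
          rw [ENNReal.ofReal_mul (by positivity), ENNReal.ofReal_mul (by positivity)]
          ring

/-- One factor [ω] is in the hypothesis and the other comes from Hölder, together with the power θ₂
that turns θ₁ - θ₂ into θ₁. Local integrability of f is obtained from the finiteness of the
oscillation integrals. -/
theorem bloNorm_le_of_weightedLowerOsc_le (hd : 0 < d) {p θ₂ : ℝ} (hp : 1 ≤ p) (hθ₂ : 0 < θ₂)
    {ρ : E d → ℝ} (hρ : ∀ x, 0 < ρ x) {ω : E d → ℝ} (hω : MemAp p ρ θ₂ ω) {f : E d → ℝ}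
    (hf : AEMeasurable f) {θ₁ C : ℝ}
    (h : ∀ (x₀ : E d) (r : ℝ), 0 < r → weightedLowerOsc p ω f (cube x₀ r)
      ≤ ENNReal.ofReal C * apConst p ρ θ₂ ω * ENNReal.ofReal ((1 + r / ρ x₀) ^ (θ₁ - θ₂))) :
    MemBLO ρ θ₁ f ∧ bloNorm ρ θ₁ f ≤
      (ENNReal.ofReal ((2 * √d) ^ d * √d ^ θ₂ * C) * apConst p ρ θ₂ ω) * apConst p ρ θ₂ ω := by
  have hp0 : 0 < p := by linarith
  have hsd := one_le_sqrt_natCast hd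
  set M := (ENNReal.ofReal ((2 * √d) ^ d * √d ^ θ₂ * C) * apConst p ρ θ₂ ω) * apConst p ρ θ₂ ω
    with hM
  have hMtop : M < ∞ := ENNReal.mul_lt_top (ENNReal.mul_lt_top ENNReal.ofReal_lt_top
    hω.apConst_lt_top) hω.apConst_lt_top
  have key (x₀ : E d) (r : ℝ) (hr : 0 < r) : ∫⁻ x in cube x₀ r, lowerOsc f (cube x₀ r) x ≤
      M * ENNReal.ofReal ((1 + r / ρ x₀) ^ θ₁) * volume (cube x₀ r) := by
    have hρ0 := hρ x₀
    have h1 : 0 < 1 + r / ρ x₀ := by positivity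
    have hH := lintegral_mul_weightedMeasure_cube_le hd hp hθ₂ hρ hω
      (aemeasurable_lowerOsc hf (cube x₀ r)) x₀ hr
    set w := weightedMeasure ω (cube x₀ r) with hw
    have hw0 : w ≠ 0 := weightedMeasure_ne_zero (hω.ae_pos hp hρ)
      hω.locallyIntegrable.aestronglyMeasurable.aemeasurable (volume_cube_ne_zero x₀ hr)
    have hwt : w ≠ ∞ := weightedMeasure_ne_top hω.locallyIntegrable (isCompact_cube x₀ hr.le)
      Subset.rfl
    set J := ∫⁻ x in cube x₀ r, lowerOsc f (cube x₀ r) x ^ p * ENNReal.ofReal (ω x) with hJ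
    have hJw : J ^ (1 / p) = weightedLowerOsc p ω f (cube x₀ r) * w ^ (1 / p) := by
      rw [weightedLowerOsc, ← ENNReal.mul_rpow_of_nonneg _ _ (by positivity), mul_comm _ w,
        ← mul_assoc, ENNReal.mul_inv_cancel hw0 hwt, one_mul]
    rw [hJw, mul_assoc, mul_comm (w ^ _), ← mul_assoc, ENNReal.mul_le_mul_iff_left
      (by simp [hw0, hwt]) (ENNReal.rpow_ne_top_of_nonneg (by positivity) hwt)] at hH
    refine hH.trans ?_
    calc _ ≤ (ENNReal.ofReal C * apConst p ρ θ₂ ω *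
          ENNReal.ofReal ((1 + r / ρ x₀) ^ (θ₁ - θ₂))) *
          (ENNReal.ofReal ((2 * √d) ^ d * √d ^ θ₂) * ENNReal.ofReal ((1 + r / ρ x₀) ^ θ₂) *
          apConst p ρ θ₂ ω * volume (cube x₀ r)) := by
            gcongr
            exact h x₀ r hr
      _ = _ := by
          have e : (1 + r / ρ x₀) ^ θ₁ = (1 + r / ρ x₀) ^ (θ₁ - θ₂) * (1 + r / ρ x₀) ^ θ₂ := by
            rw [← Real.rpow_add h1]; ring_nf
          rw [e, hM, ENNReal.ofReal_mul (q := C) (by positivity),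
            ENNReal.ofReal_mul (q := (1 + r / ρ x₀) ^ θ₂) (by positivity)]
          ring
  have hle : bloNorm ρ θ₁ f ≤ M := bloNorm_le hρ key
  refine ⟨⟨fun x => ?_, hle.trans_lt hMtop⟩, hle⟩
  refine ⟨cube x (2 * 1), Filter.mem_of_superset (Metric.ball_mem_nhds x one_pos)
    (ball_subset_cube x 1), ?_⟩
  refine integrableOn_of_lintegral_lowerOsc_ne_top hf (volume_cube_ne_zero x (by norm_num))
    (volume_cube_ne_top x (by norm_num)) ?_
  refine ((key x _ (by norm_num)).trans_lt ?_).ne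
  exact ENNReal.mul_lt_top (ENNReal.mul_lt_top hMtop ENNReal.ofReal_lt_top)
    (volume_cube_ne_top x (by norm_num)).lt_top

/-! ### Part (0): comparison of a weight with Lebesgue measure -/

/-- Power-type decay of the mass of a set in terms of its volume. -/
theorem measure_le_rpow_mul_of_forall_subcube {μ : Measure (E d)} (hμ : μ ≪ volume) {x₀ : E d}
    {r : ℝ} (hr : 0 < r) {v : ℝ≥0∞} (hv0 : v ≠ 0) (hv : v ≤ volume (cube x₀ r)) {δ : ℝ}
    (hδ : 0 < δ)
    (H : ∀ (y : E d) (l : ℝ), 0 < l → cube y l ⊆ cube x₀ r → volume (cube y l) ≤ v →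
      ∀ S, MeasurableSet S → S ⊆ cube y l → volume S ≤ 2⁻¹ * volume (cube y l) →
        μ S ≤ ENNReal.ofReal ((2 ^ (d + 1)) ^ (-δ)) * μ (cube y l))
    {S : Set (E d)} (hS : MeasurableSet S) (hSQ : S ⊆ cube x₀ r) :
    μ S ≤ ENNReal.ofReal ((2 ^ (d + 1)) ^ δ) * (volume S / v) ^ δ * μ (cube x₀ r) := by
  have hvt : v ≠ ∞ := (hv.trans_lt (volume_cube_ne_top x₀ hr.le).lt_top).ne
  set G : ℝ := 2 ^ (d + 1) with hG
  have hG1 : 1 < G := one_lt_pow₀ (by norm_num) (by simp)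
  have hG0 : 0 < G := by linarith
  have hGE : (2 ^ d / 2⁻¹ : ℝ≥0∞) = ENNReal.ofReal G := by
    rw [hG, ENNReal.ofReal_pow (by norm_num), ENNReal.div_eq_inv_mul, inv_inv, pow_succ']
    simp
  by_cases hS0 : volume S = 0
  · rw [hμ hS0]; exact zero_le
  have hSt : volume S ≠ ∞ := (measure_mono hSQ).trans_lt (volume_cube_ne_top x₀ hr.le).lt_top |>.ne
  -- For |S| ≥ v the right side already exceeds the whole mass.
  rcases le_total v (volume S) with hvS | hSv
  · refine (measure_mono hSQ).trans (le_mul_of_one_le_left' ?_)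
    refine one_le_mul ?_ ?_
    · rw [ENNReal.one_le_ofReal]
      exact Real.one_le_rpow hG1.le hδ.le
    · refine ENNReal.one_le_rpow ?_ hδ
      rwa [ENNReal.le_div_iff_mul_le (Or.inl hv0) (Or.inl hvt), one_mul]
  · set x : ℝ := (v / volume S).toReal with hx
    have hxE : ENNReal.ofReal x = v / volume S :=
      ENNReal.ofReal_toReal (ENNReal.div_ne_top hvt hS0)
    have hx1 : 1 ≤ x := by
      rw [← ENNReal.one_le_ofReal, hxE, ENNReal.le_div_iff_mul_le (Or.inl hS0) (Or.inl hSt),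
        one_mul]
      exact hSv
    have hx0 : 0 < x := by linarith
    -- Here G^n ≤ v/|S| < G^(n+1), with G the volume growth per stopping step at a = 1/2; the
    -- incomplete last step costs the factor G^δ.
    obtain ⟨n, hn1, hn2⟩ := exists_nat_pow_near hx1 hG1
    have h1 := measure_le_pow_mul_of_forall_subcube hμ hr hv (a := 2⁻¹) (by simp)
      (by simp) H n S hS hSQ (by
        rw [hGE, ← ENNReal.ofReal_pow hG0.le]
        calc _ ≤ ENNReal.ofReal x * volume S := by gcongr
          _ = v := by rw [hxE, ENNReal.div_mul_cancel hS0 hSt])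
    refine h1.trans ?_
    gcongr
    have h2 : volume S / v = ENNReal.ofReal x⁻¹ := by
      rw [ENNReal.ofReal_inv_of_pos hx0, hxE, ENNReal.inv_div (Or.inl hSt) (Or.inl hS0)]
    rw [h2, ENNReal.ofReal_rpow_of_pos (by positivity), ← ENNReal.ofReal_mul (by positivity),
      ← ENNReal.ofReal_pow (by positivity)]
    refine ENNReal.ofReal_le_ofReal ?_
    rw [← Real.mul_rpow hG0.le (by positivity), ← Real.rpow_natCast, ← Real.rpow_mul hG0.le,
      neg_mul, mul_comm δ, ← neg_mul, Real.rpow_mul hG0.le]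
    refine Real.rpow_le_rpow (by positivity) ?_ hδ.le
    rw [Real.rpow_neg hG0.le, Real.rpow_natCast, ← div_eq_mul_inv, le_div_iff₀ hx0,
      inv_mul_le_iff₀ (by positivity), ← pow_succ]
    exact hn2.le

theorem radius_lower_bound (hd : 0 < d) {ρ : E d → ℝ} (hρ : ∀ x, 0 < ρ x) {C₀ N₀ : ℝ}
    (hC₀ : 1 ≤ C₀) (hN₀ : 0 < N₀) (h : RadiusComparison ρ C₀ N₀) {x₀ y : E d} {r : ℝ} (hr : 0 < r)
    (hy : y ∈ cube x₀ r) :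
    ρ x₀ ≤ C₀ * √d ^ N₀ * (1 + r / ρ x₀) ^ N₀ * ρ y := by
  have hρ0 := hρ x₀
  have hsd := one_le_sqrt_natCast hd
  have h1 := (h x₀ y).1
  rw [le_div_iff₀ hρ0] at h1
  have h2 : ‖x₀ - y‖ ≤ √d * r := by
    rw [norm_sub_rev]
    refine (norm_sub_le_of_mem_cube hr.le hy).trans ?_
    gcongr; linarith
  have h3 : (1 + ‖x₀ - y‖ / ρ x₀) ^ N₀ ≤ √d ^ N₀ * (1 + r / ρ x₀) ^ N₀ := by
    refine le_trans ?_ (one_add_mul_div_rpow_le hsd hr.le hρ0.le hN₀.le)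
    gcongr
  have h4 : 0 < (1 + ‖x₀ - y‖ / ρ x₀) ^ N₀ := by positivity
  rw [Real.rpow_neg (by positivity)] at h1
  have h5 : ρ x₀ ≤ C₀ * (1 + ‖x₀ - y‖ / ρ x₀) ^ N₀ * ρ y := by
    calc ρ x₀ = C₀ * (1 + ‖x₀ - y‖ / ρ x₀) ^ N₀ *
          (1 / C₀ * ((1 + ‖x₀ - y‖ / ρ x₀) ^ N₀)⁻¹ * ρ x₀) := by field_simp
      _ ≤ _ := by gcongr
  refine h5.trans ?_
  rw [mul_assoc C₀ (√d ^ N₀)]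
  have := hρ y
  gcongr

theorem le_of_volume_cube_le (hd : 0 < d) {x y : E d} {l s : ℝ} (hl : 0 ≤ l) (hs : 0 ≤ s)
    (h : volume (cube y l) ≤ volume (cube x s)) : l ≤ s := by
  rw [volume_cube _ hl, volume_cube _ hs, ENNReal.ofReal_le_ofReal_iff (by positivity)] at h
  exact (pow_le_pow_iff_left₀ hl hs hd.ne').1 h

/-- Hölder for the indicator of the complement Q \ S, which has at least half the volume, gives it
at least the share (2D)^(-p) of the mass. The bound l ≤ ρ(y) replaces the growth factor by 2^θ. -/
theorem weightedMeasure_le_of_le_radius (hd : 0 < d) {p θ : ℝ} (hp : 1 ≤ p) (hθ : 0 < θ)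
    {ρ : E d → ℝ} (hρ : ∀ x, 0 < ρ x) {ω : E d → ℝ} (hω : MemAp p ρ θ ω) {D : ℝ} (hD1 : 1 ≤ D)
    (hD : ENNReal.ofReal ((2 * √d) ^ d * √d ^ θ) * ENNReal.ofReal (2 ^ θ) * apConst p ρ θ ω ≤
      ENNReal.ofReal D) {y : E d} {l : ℝ} (hl : 0 < l) (hlρ : l ≤ ρ y) {S : Set (E d)}
    (hS : MeasurableSet S) (hSQ : S ⊆ cube y l) (hvol : volume S ≤ 2⁻¹ * volume (cube y l)) :
    weightedMeasure ω S ≤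
      ENNReal.ofReal (1 - ((2 * D) ^ p)⁻¹) * weightedMeasure ω (cube y l) := by
  have hp0 : 0 < p := by linarith
  have hD0 : 0 < D := by linarith
  set Q := cube y l with hQ
  have hQm : MeasurableSet Q := measurableSet_cube y l
  have hQ0 : volume Q ≠ 0 := volume_cube_ne_zero y hl
  have hQt : volume Q ≠ ∞ := volume_cube_ne_top y hl.le
  have hTm : MeasurableSet (Q \ S) := hQm.diff hS
  set w := weightedMeasure ω Q with hw
  have hwt : w ≠ ∞ := weightedMeasure_ne_top hω.locallyIntegrable (isCompact_cube y hl.le)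
    Subset.rfl
  have h1 := lintegral_mul_weightedMeasure_cube_le hd hp hθ hρ hω
    (g := (Q \ S).indicator fun _ => 1) (aemeasurable_const.indicator hTm) y hl
  have h2 : ∫⁻ x in Q, (Q \ S).indicator (fun _ => (1 : ℝ≥0∞)) x = volume (Q \ S) := by
    rw [lintegral_indicator_const hTm, one_mul, Measure.restrict_apply hTm,
      inter_eq_self_of_subset_left sdiff_subset]
  have h3 : ∫⁻ x in Q, (Q \ S).indicator (fun _ => (1 : ℝ≥0∞)) x ^ p * ENNReal.ofReal (ω x) =
      weightedMeasure ω (Q \ S) := by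
    have : (fun x => (Q \ S).indicator (fun _ => (1 : ℝ≥0∞)) x ^ p * ENNReal.ofReal (ω x)) =
        (Q \ S).indicator fun x => ENNReal.ofReal (ω x) := by
      funext x
      by_cases hx : x ∈ Q \ S
      · rw [indicator_of_mem hx, indicator_of_mem hx]; simp
      · rw [indicator_of_notMem hx, indicator_of_notMem hx]; simp [hp0]
    rw [this, lintegral_indicator hTm, Measure.restrict_restrict hTm,
      inter_eq_self_of_subset_left sdiff_subset]
    rfl
  rw [← hQ, h2, h3] at h1
  have hsplit (μ : Measure (E d)) : μ S + μ (Q \ S) = μ Q := by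
    have := measure_inter_add_sdiff (μ := μ) Q hS
    rwa [inter_eq_self_of_subset_right hSQ] at this
  have h4 : volume Q ≤ 2 * volume (Q \ S) := by
    have h5 : 2⁻¹ * volume Q + 2⁻¹ * volume Q ≤ 2⁻¹ * volume Q + volume (Q \ S) := by
      rw [← add_mul, ENNReal.inv_two_add_inv_two, one_mul]
      nth_rw 1 [← hsplit volume]
      gcongr
    rw [ENNReal.add_le_add_iff_left (by finiteness)] at h5
    rwa [ENNReal.inv_mul_le_iff (by simp) (by simp)] at h5
  have h6 : w ^ (1 / p) ≤ ENNReal.ofReal (2 * D) * weightedMeasure ω (Q \ S) ^ (1 / p) := by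
    have hρy := hρ y
    have h6 : ENNReal.ofReal ((2 * √d) ^ d * √d ^ θ) * ENNReal.ofReal ((1 + l / ρ y) ^ θ) *
        apConst p ρ θ ω ≤ ENNReal.ofReal D := by
      refine le_trans ?_ hD
      gcongr
      have : l / ρ y ≤ 1 := (div_le_one hρy).2 hlρ
      linarith
    have h7 : volume Q * w ^ (1 / p) ≤ volume Q *
        (ENNReal.ofReal (2 * D) * weightedMeasure ω (Q \ S) ^ (1 / p)) := by
      calc volume Q * w ^ (1 / p) ≤ 2 * volume (Q \ S) * w ^ (1 / p) := by gcongr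
        _ = 2 * (volume (Q \ S) * w ^ (1 / p)) := by ring
        _ ≤ 2 * (weightedMeasure ω (Q \ S) ^ (1 / p) * (ENNReal.ofReal D * volume Q)) := by
          refine mul_le_mul_right (h1.trans ?_) _
          gcongr
        _ = _ := by
          rw [ENNReal.ofReal_mul (by norm_num)]
          simp only [ENNReal.ofReal_ofNat]
          ring
    exact (ENNReal.mul_le_mul_iff_right hQ0 hQt).1 h7
  have h7 : w ≤ ENNReal.ofReal ((2 * D) ^ p) * weightedMeasure ω (Q \ S) := by
    have := ENNReal.rpow_le_rpow h6 hp0.le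
    rwa [ENNReal.mul_rpow_of_nonneg _ _ hp0.le, ← ENNReal.rpow_mul, ← ENNReal.rpow_mul,
      one_div_mul_cancel hp0.ne', ENNReal.rpow_one, ENNReal.rpow_one,
      ENNReal.ofReal_rpow_of_pos (by positivity)] at this
  have h8 : weightedMeasure ω S + weightedMeasure ω (Q \ S) = w := by
    rw [weightedMeasure_eq_withDensity _ hS, weightedMeasure_eq_withDensity _ hTm, hw,
      weightedMeasure_eq_withDensity _ hQm]
    exact hsplit _
  have hX : 1 ≤ (2 * D) ^ p := Real.one_le_rpow (by linarith) hp0.le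
  have h9 : ENNReal.ofReal ((2 * D) ^ p)⁻¹ * w ≤ weightedMeasure ω (Q \ S) := by
    rw [ENNReal.ofReal_inv_of_pos (by positivity)]
    exact (ENNReal.inv_mul_le_iff (by simp; positivity) ENNReal.ofReal_ne_top).2 h7
  have h10 : weightedMeasure ω S + ENNReal.ofReal ((2 * D) ^ p)⁻¹ * w ≤
      ENNReal.ofReal (1 - ((2 * D) ^ p)⁻¹) * w + ENNReal.ofReal ((2 * D) ^ p)⁻¹ * w := by
    rw [← add_mul, ← ENNReal.ofReal_add (by linarith [inv_le_one_of_one_le₀ hX])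
      (by positivity), sub_add_cancel, ENNReal.ofReal_one, one_mul]
    calc _ ≤ weightedMeasure ω S + weightedMeasure ω (Q \ S) := by gcongr
      _ = w := h8
  exact (ENNReal.add_le_add_iff_right (ENNReal.mul_ne_top ENNReal.ofReal_ne_top hwt)).1 h10

theorem exists_weightComparison (hd : 0 < d) {p θ : ℝ} (hp : 1 ≤ p) (hθ : 0 < θ)
    {ρ : E d → ℝ} (hρ : ∀ x, 0 < ρ x) {C₀ N₀ : ℝ} (hC₀ : 1 ≤ C₀) (hN₀ : 0 < N₀)
    (hcomp : RadiusComparison ρ C₀ N₀) (K : ℝ≥0) :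
    ∃ δ η A : ℝ, 0 < δ ∧ δ < 1 ∧ 1 < η ∧ 0 < A ∧
      ∀ ω : E d → ℝ, MemAp p ρ θ ω → apConst p ρ θ ω ≤ K → WeightComparison ρ ω δ η A := by
  have hp0 : 0 < p := by linarith
  have hsd := one_le_sqrt_natCast hd
  set D : ℝ := max 1 ((2 * √d) ^ d * √d ^ θ * 2 ^ θ * K) with hD
  have hD1 : 1 ≤ D := le_max_left _ _
  set β : ℝ := 1 - ((2 * D) ^ p)⁻¹ with hβ
  have hX : 2 ≤ (2 * D) ^ p := by
    calc (2 : ℝ) ≤ 2 * D := by linarith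
      _ = (2 * D) ^ (1 : ℝ) := (Real.rpow_one _).symm
      _ ≤ (2 * D) ^ p := Real.rpow_le_rpow_of_exponent_le (by linarith) hp
  have hβ2 : 2⁻¹ ≤ β := by
    have : ((2 * D) ^ p)⁻¹ ≤ 2⁻¹ := by gcongr
    rw [hβ]; linarith
  have hβ1 : β < 1 := by
    have : 0 < ((2 * D) ^ p)⁻¹ := by positivity
    rw [hβ]; linarith
  have hβ0 : 0 < β := by linarith
  set G : ℝ := 2 ^ (d + 1) with hG
  have hG4 : 4 ≤ G := by
    calc (4 : ℝ) = 2 ^ 2 := by norm_num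
      _ ≤ 2 ^ (d + 1) := pow_le_pow_right₀ (by norm_num) (by omega)
  -- Chosen so that G^(-δ) = β, the loss of mass per stopping step. The bounds β ≥ 1/2 and G ≥ 4
  -- keep δ below 1.
  set δ : ℝ := -Real.logb G β with hδ
  have hδ0 : 0 < δ := neg_pos.2 (Real.logb_neg (by linarith) hβ0 hβ1)
  have hδ1 : δ < 1 := by
    have : -1 < Real.logb G β := by
      rw [Real.lt_logb_iff_rpow_lt (by linarith) hβ0, Real.rpow_neg_one]
      calc G⁻¹ ≤ 4⁻¹ := by gcongr
        _ < β := by linarith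
    rw [hδ]; linarith
  have hGδ : G ^ (-δ) = β := by
    rw [hδ, neg_neg, Real.rpow_logb (by linarith) (by linarith) hβ0]
  set c : ℝ := (C₀ * √d ^ N₀)⁻¹ with hc
  have hcc : 1 ≤ C₀ * √d ^ N₀ := one_le_mul_of_one_le_of_one_le hC₀
    (Real.one_le_rpow hsd hN₀.le)
  have hc0 : 0 < c := by positivity
  have hc1 : c ≤ 1 := inv_le_one_of_one_le₀ hcc
  -- The needed exponent is (N₀+1)dδ; the maximum with 2 only ensures η > 1.
  refine ⟨δ, max 2 ((N₀ + 1) * (d * δ)), G ^ δ * c ^ (-(d * δ)), hδ0, hδ1,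
    lt_of_lt_of_le (by norm_num) (le_max_left _ _), by positivity, ?_⟩
  intro ω hω hK x₀ r hr S hS hSQ
  have hρ0 := hρ x₀
  set u : ℝ := 1 + r / ρ x₀ with hu
  have hu1 : 1 ≤ u := by rw [hu]; have : 0 < r / ρ x₀ := by positivity
                         linarith
  have hu0 : 0 < u := by linarith
  -- Subcubes of side at most t r are subcritical: r ≤ u ρ(x₀), and ρ(x₀) ≤ c⁻¹ u^N₀ ρ(y). Measuring
  -- S against volume (t r)^d instead of r^d costs t^(-dδ), which is a constant times a power of u.
  set t : ℝ := c * u ^ (-(N₀ + 1)) with ht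
  have ht0 : 0 < t := by positivity
  have ht1 : t ≤ 1 := mul_le_one₀ hc1 (by positivity)
    (Real.rpow_le_one_of_one_le_of_nonpos hu1 (by linarith))
  have hDE : ENNReal.ofReal ((2 * √d) ^ d * √d ^ θ) * ENNReal.ofReal (2 ^ θ) * apConst p ρ θ ω ≤
      ENNReal.ofReal D := by
    calc _ ≤ ENNReal.ofReal ((2 * √d) ^ d * √d ^ θ) * ENNReal.ofReal (2 ^ θ) *
          ENNReal.ofReal (K : ℝ) := by gcongr; simpa using hK
      _ = ENNReal.ofReal ((2 * √d) ^ d * √d ^ θ * 2 ^ θ * K) := by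
          rw [← ENNReal.ofReal_mul (by positivity), ← ENNReal.ofReal_mul (by positivity)]
      _ ≤ _ := ENNReal.ofReal_le_ofReal (le_max_right _ _)
  have hvol : volume (cube x₀ (t * r)) = ENNReal.ofReal (t ^ d) * volume (cube x₀ r) := by
    rw [volume_cube _ (by positivity), volume_cube _ hr.le, ← ENNReal.ofReal_mul (by positivity),
      mul_pow]
  have hmain := measure_le_rpow_mul_of_forall_subcube
    (withDensity_absolutelyContinuous volume fun x => ENNReal.ofReal (ω x)) hr
    (volume_cube_ne_zero x₀ (r := t * r) (by positivity)) (by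
      rw [hvol]
      refine mul_le_of_le_one_left' ?_
      rw [ENNReal.ofReal_le_one]
      exact pow_le_one₀ ht0.le ht1) hδ0 (by
      intro y l hl hlQ hlv S' hS' hS'Q hS'v
      rw [hGδ, ← weightedMeasure_eq_withDensity _ hS',
        ← weightedMeasure_eq_withDensity _ (measurableSet_cube y l)]
      refine weightedMeasure_le_of_le_radius hd hp hθ hρ hω hD1 hDE hl ?_ hS' hS'Q hS'v
      refine (le_of_volume_cube_le hd hl.le (by positivity) hlv).trans ?_
      have hlow := radius_lower_bound hd hρ hC₀ hN₀ hcomp hr (hlQ (mem_cube_self y hl.le))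
      have hρy := hρ y
      have e1 : r ≤ u * ρ x₀ := by rw [hu]; field_simp; linarith
      have e2 : u ^ (-(N₀ + 1)) * (u * u ^ N₀) = 1 := by
        nth_rw 2 [← Real.rpow_one u]
        rw [← Real.rpow_add hu0, ← Real.rpow_add hu0,
          show -(N₀ + 1) + (1 + N₀) = 0 by ring, Real.rpow_zero]
      calc t * r ≤ t * (u * (C₀ * √d ^ N₀ * u ^ N₀ * ρ y)) := by
            gcongr
            exact e1.trans (by gcongr)
        _ = (c * (C₀ * √d ^ N₀)) * (u ^ (-(N₀ + 1)) * (u * u ^ N₀)) * ρ y := by rw [ht]; ring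
        _ = ρ y := by rw [e2, hc, inv_mul_cancel₀ (by positivity), one_mul, one_mul]) hS hSQ
  rw [← weightedMeasure_eq_withDensity _ hS,
    ← weightedMeasure_eq_withDensity _ (measurableSet_cube x₀ r)] at hmain
  refine ENNReal.div_le_of_le_mul (hmain.trans (mul_le_mul_left ?_ _))
  have hQ0 := volume_cube_ne_zero x₀ hr
  have hQt := volume_cube_ne_top x₀ hr.le
  have e3 : volume S / volume (cube x₀ (t * r)) =
      ENNReal.ofReal t⁻¹ ^ d * (volume S / volume (cube x₀ r)) := by
    rw [hvol, ENNReal.ofReal_inv_of_pos ht0, ENNReal.ofReal_pow ht0.le, ENNReal.inv_pow.symm,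
      div_eq_mul_inv, div_eq_mul_inv, ENNReal.mul_inv (Or.inr hQt) (Or.inr hQ0)]
    ring
  have e4 : (t⁻¹ ^ d) ^ δ ≤ c ^ (-(d * δ)) * u ^ (max 2 ((N₀ + 1) * (d * δ))) := by
    have : (t⁻¹ ^ d) ^ δ = c ^ (-(d * δ)) * u ^ ((N₀ + 1) * (d * δ)) := by
      rw [← Real.rpow_natCast, ← Real.rpow_mul (by positivity), Real.inv_rpow ht0.le,
        ← Real.rpow_neg ht0.le, ht, Real.mul_rpow hc0.le (by positivity), ← Real.rpow_mul hu0.le]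
      congr 2; ring
    rw [this]
    refine mul_le_mul_of_nonneg_left ?_ (by positivity)
    exact Real.rpow_le_rpow_of_exponent_le hu1 (le_max_right _ _)
  rw [e3, ENNReal.mul_rpow_of_nonneg _ _ hδ0.le, ← ENNReal.ofReal_pow (by positivity),
    ENNReal.ofReal_rpow_of_pos (by positivity)]
  calc ENNReal.ofReal (G ^ δ) * (ENNReal.ofReal ((t⁻¹ ^ d) ^ δ) *
        (volume S / volume (cube x₀ r)) ^ δ)
      ≤ ENNReal.ofReal (G ^ δ) * (ENNReal.ofReal (c ^ (-(d * δ)) *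
        u ^ (max 2 ((N₀ + 1) * (d * δ)))) * (volume S / volume (cube x₀ r)) ^ δ) := by gcongr
    _ = _ := by
      rw [ENNReal.ofReal_mul (by positivity), ENNReal.ofReal_mul (by positivity)]
      ring

/-! ### Part (1): weighted oscillation of BLO functions -/

theorem summable_rpow_mul_geometric {p q : ℝ} (hq0 : 0 < q) (hq1 : q < 1) :
    Summable fun k : ℕ => ((k : ℝ) + 1) ^ p * q ^ k := by
  have h1 : Summable fun k : ℕ => ((k : ℝ) ^ ⌈p⌉₊ * q ^ k) :=
    summable_pow_mul_geometric_of_norm_lt_one _ (by rwa [Real.norm_of_nonneg hq0.le])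
  have h2 : Summable fun k : ℕ => q⁻¹ * (((k + 1 : ℕ) : ℝ) ^ ⌈p⌉₊ * q ^ (k + 1)) :=
    ((summable_nat_add_iff 1).2 h1).mul_left _
  refine Summable.of_nonneg_of_le (fun k => by positivity) (fun k => ?_) h2
  have h3 : ((k : ℝ) + 1) ^ p ≤ ((k + 1 : ℕ) : ℝ) ^ ⌈p⌉₊ := by
    rw [← Real.rpow_natCast, Nat.cast_succ]
    exact Real.rpow_le_rpow_of_exponent_le (by linarith [k.cast_nonneg (α := ℝ)]) (Nat.le_ceil p)
  calc ((k : ℝ) + 1) ^ p * q ^ k ≤ ((k + 1 : ℕ) : ℝ) ^ ⌈p⌉₊ * q ^ k := by gcongr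
    _ = _ := by rw [pow_succ q]; field_simp

/-- The layer-cake bound of a `p`-th power by a sum over the layers of height `b`. -/
theorem rpow_le_tsum_indicator {α : Type*} {p : ℝ} (hp : 0 < p) {b : ℝ≥0∞} (hb0 : b ≠ 0)
    {h : α → ℝ≥0∞} {T : ℕ → Set α} {x : α} (hx : h x ≠ ∞)
    (hT : ∀ k : ℕ, (k : ℝ≥0∞) * b < h x → x ∈ T k) :
    h x ^ p ≤ ∑' k : ℕ, (((k : ℝ≥0∞) + 1) * b) ^ p * (T k).indicator (fun _ => 1) x := by
  classical
  obtain ⟨n, hn⟩ := ENNReal.exists_nat_mul_gt hb0 hx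
  have hex : ∃ n : ℕ, h x ≤ n * b := ⟨n, hn.le⟩
  rcases hk : Nat.find hex with _ | k
  · have := Nat.find_spec hex
    rw [hk, Nat.cast_zero, zero_mul, nonpos_iff_eq_zero] at this
    rw [this, ENNReal.zero_rpow_of_pos hp]
    exact zero_le
  · have h1 := Nat.find_spec hex
    rw [hk, Nat.cast_succ] at h1
    have h2 : (k : ℝ≥0∞) * b < h x := not_le.1 (Nat.find_min hex (by omega))
    refine le_trans ?_ (ENNReal.le_tsum k)
    rw [indicator_of_mem (hT k h2), mul_one]
    exact ENNReal.rpow_le_rpow h1 hp.le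

/-- Tested on the ball of centre 0 and radius ρ(0), where the growth factor is 2^θ. This permits
inserting [ω] into an estimate that does not produce it. -/
theorem one_le_apConst {p θ : ℝ} (hp : 1 ≤ p) {ρ : E d → ℝ} (hρ : ∀ x, 0 < ρ x) {ω : E d → ℝ}
    (hω : MemAp p ρ θ ω) : 1 ≤ ENNReal.ofReal (2 ^ θ) * apConst p ρ θ ω := by
  have hρ0 := hρ 0
  refine (one_le_muckenhoupt hp (hω.ae_pos hp hρ) hω.locallyIntegrable 0 hρ0).trans ?_
  refine (muckenhoupt_le_apConst (θ := θ) hρ ω 0 hρ0).trans (le_of_eq ?_)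
  rw [div_self hρ0.ne', one_add_one_eq_two]

/-- A small cube may lie where ρ is small. By the lower comparison, l/ρ(y) ≤ r/ρ(y) is still bounded
by a multiple of u^(N₀+1), and this is the origin of the exponent (N₀+1)θ₁. -/
theorem lintegral_lowerOsc_subcube_le (hd : 0 < d) {ρ : E d → ℝ} (hρ : ∀ x, 0 < ρ x) {C₀ N₀ : ℝ}
    (hC₀ : 1 ≤ C₀) (hN₀ : 0 < N₀) (hcomp : RadiusComparison ρ C₀ N₀) {θ : ℝ} (hθ : 0 < θ)
    {f : E d → ℝ} {x₀ : E d} {r : ℝ} (hr : 0 < r) {y : E d} {l : ℝ} (hl : 0 < l)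
    (hlQ : cube y l ⊆ cube x₀ r) :
    ∫⁻ x in cube y l, lowerOsc f (cube y l) x ≤
      bloNorm ρ θ f * ENNReal.ofReal ((2 * (C₀ * √d ^ N₀)) ^ θ *
        (1 + r / ρ x₀) ^ ((N₀ + 1) * θ)) * volume (cube y l) := by
  refine (lintegral_lowerOsc_le (θ := θ) hρ y hl).trans ?_
  gcongr
  have hsd := one_le_sqrt_natCast hd
  have hρ0 := hρ x₀
  have hρy := hρ y
  have hcc : 1 ≤ C₀ * √d ^ N₀ := one_le_mul_of_one_le_of_one_le hC₀
    (Real.one_le_rpow hsd hN₀.le)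
  have hlr : l ≤ r := le_of_volume_cube_le hd hl.le hr.le (measure_mono hlQ)
  have hlow := radius_lower_bound hd hρ hC₀ hN₀ hcomp hr (hlQ (mem_cube_self y hl.le))
  set c := C₀ * √d ^ N₀
  have hr0 : 0 < r / ρ x₀ := by positivity
  set u : ℝ := 1 + r / ρ x₀ with hu
  have hu1 : 1 ≤ u := by rw [hu]; linarith
  have hu0 : 0 < u := by linarith
  rw [Real.rpow_mul hu0.le, ← Real.mul_rpow (by positivity) (by positivity)]
  refine Real.rpow_le_rpow (by positivity) ?_ hθ.le
  have h1 : l / ρ y ≤ c * u ^ (N₀ + 1) := by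
    rw [div_le_iff₀ hρy, Real.rpow_add hu0, Real.rpow_one]
    have e1 : r ≤ u * ρ x₀ := by rw [hu]; field_simp; linarith
    calc l ≤ u * ρ x₀ := hlr.trans e1
      _ ≤ u * (c * u ^ N₀ * ρ y) := by gcongr
      _ = _ := by ring
  have h2 : 1 ≤ c * u ^ (N₀ + 1) :=
    one_le_mul_of_one_le_of_one_le hcc (Real.one_le_rpow hu1 (by linarith))
  linarith

theorem weightedLowerOsc_le (hd : 0 < d) {p θ₁ θ₂ : ℝ} (hp : 1 ≤ p)
    {ρ : E d → ℝ} (hρ : ∀ x, 0 < ρ x) {C₀ N₀ : ℝ} (hC₀ : 1 ≤ C₀) (hN₀ : 0 < N₀)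
    (hcomp : RadiusComparison ρ C₀ N₀) {δ η A : ℝ} (hδ : 0 < δ) (hA : 0 < A) (hθ₁ : 0 < θ₁) :
    ∃ C : ℝ, 0 < C ∧ ∀ ω : E d → ℝ, MemAp p ρ θ₂ ω → WeightComparison ρ ω δ η A →
      ∀ f : E d → ℝ, MemBLO ρ θ₁ f → ∀ (x₀ : E d) (r : ℝ), 0 < r →
        weightedLowerOsc p ω f (cube x₀ r) ≤ ENNReal.ofReal C * apConst p ρ θ₂ ω *
          ENNReal.ofReal ((1 + r / ρ x₀) ^ ((N₀ + 1) * θ₁ + η / p)) * bloNorm ρ θ₁ f := by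
  have hp0 : 0 < p := by linarith
  have hsd := one_le_sqrt_natCast hd
  set q : ℝ := (2⁻¹) ^ δ with hq
  have hq0 : 0 < q := by positivity
  have hq1 : q < 1 := Real.rpow_lt_one (by norm_num) (by norm_num) hδ
  have hsum := summable_rpow_mul_geometric (p := p) hq0 hq1
  set σ : ℝ := ∑' k : ℕ, ((k : ℝ) + 1) ^ p * q ^ k with hσ
  have hσ0 : 0 < σ := hsum.tsum_pos (fun k => by positivity) 0 (by positivity)
  have hσE : ∑' k : ℕ, ((k : ℝ≥0∞) + 1) ^ p * ENNReal.ofReal q ^ k = ENNReal.ofReal σ := by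
    rw [hσ, ENNReal.ofReal_tsum_of_nonneg (fun k => by positivity) hsum]
    refine tsum_congr fun k => ?_
    have hk : (k : ℝ≥0∞) + 1 = ENNReal.ofReal ((k : ℝ) + 1) := by
      rw [ENNReal.ofReal_add (by positivity) (by simp)]; simp
    rw [ENNReal.ofReal_mul (by positivity), ENNReal.ofReal_pow hq0.le, hk,
      ENNReal.ofReal_rpow_of_pos (by positivity)]
  set c : ℝ := (2 * (C₀ * √d ^ N₀)) ^ θ₁ with hc
  have hc0 : 0 < c := by positivity
  -- 2^(d+1) c is the layer height per unit of u^((N₀+1)θ₁) ‖f‖, (Aσ)^(1/p) the p-th root of the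
  -- layer sum, and 2^θ₂ pays for the insertion of [ω].
  refine ⟨(2 ^ (d + 1) * c * (A * σ) ^ (1 / p)) * 2 ^ θ₂, by positivity, ?_⟩
  intro ω hω hwc f hf x₀ r hr
  have hρ0 := hρ x₀
  have hfm : AEMeasurable f := hf.1.aestronglyMeasurable.aemeasurable
  have hωm : AEMeasurable fun x => ENNReal.ofReal (ω x) :=
    hω.locallyIntegrable.aestronglyMeasurable.aemeasurable.ennreal_ofReal
  set u : ℝ := 1 + r / ρ x₀ with hu
  have hu0 : 0 < u := by positivity
  set N := bloNorm ρ θ₁ f with hN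
  have hNt : N ≠ ∞ := hf.2.ne
  set L : ℝ≥0∞ := N * ENNReal.ofReal (c * u ^ ((N₀ + 1) * θ₁)) with hL
  have hLt : L ≠ ∞ := ENNReal.mul_ne_top hNt ENNReal.ofReal_ne_top
  set Q := cube x₀ r with hQ
  have hQm : MeasurableSet Q := measurableSet_cube x₀ r
  have hQ0 : volume Q ≠ 0 := volume_cube_ne_zero x₀ hr
  have hQt : volume Q ≠ ∞ := volume_cube_ne_top x₀ hr.le
  have hsub (y : E d) (l : ℝ) (hl : 0 < l) (hlQ : cube y l ⊆ Q) :
      ∫⁻ x in cube y l, lowerOsc f (cube y l) x ≤ L * volume (cube y l) :=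
    lintegral_lowerOsc_subcube_le hd hρ hC₀ hN₀ hcomp hθ₁ hr hl hlQ
  set h := lowerOsc f Q with hh
  have hhm : AEMeasurable h := aemeasurable_lowerOsc hfm Q
  have hint := hsub x₀ r hr Subset.rfl
  -- John–Nirenberg needs a positive layer height; for L = 0 the oscillation vanishes almost
  -- everywhere.
  by_cases hL0 : L = 0
  · have h0 : h =ᵐ[volume.restrict Q] 0 := by
      rw [hL0, zero_mul, nonpos_iff_eq_zero, lintegral_eq_zero_iff' hhm.restrict] at hint
      exact hint
    have h1 : ∫⁻ x in Q, h x ^ p * ENNReal.ofReal (ω x) = 0 := by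
      have hpm : AEMeasurable (fun x => h x ^ p * ENNReal.ofReal (ω x)) (volume.restrict Q) :=
        ((hhm.pow_const p).mul hωm).restrict
      rw [lintegral_eq_zero_iff' hpm]
      filter_upwards [h0] with x hx
      simp [hx, hp0]
    rw [weightedLowerOsc, h1, mul_zero, ENNReal.zero_rpow_of_pos (by positivity)]
    exact zero_le
  set b : ℝ≥0∞ := 2 ^ (d + 1) * L with hb
  have hb0 : b ≠ 0 := mul_ne_zero (by positivity) hL0
  obtain ⟨m, hm, -, -⟩ := exists_essInf_eq_coe hQ0
    (hint.trans_lt (ENNReal.mul_lt_top hLt.lt_top hQt.lt_top)).ne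
  -- The weight comparison needs measurable sets, while f is only almost everywhere measurable; the
  -- measurable hull has the same volume.
  set T : ℕ → Set (E d) := fun k => toMeasurable volume {x ∈ Q | (k : ℝ≥0∞) * b < h x} ∩ Q with hT
  have hTm (k : ℕ) : MeasurableSet (T k) := (measurableSet_toMeasurable _ _).inter hQm
  have hTv (k : ℕ) : volume (T k) ≤ 2⁻¹ ^ k * volume Q :=
    (measure_mono inter_subset_left).trans
      ((measure_toMeasurable _).trans_le (volume_lowerOsc_gt_le hfm hL0 hLt hsub k x₀ r hr
        Subset.rfl))
  have hTw (k : ℕ) : (weightedMeasure ω Q)⁻¹ * weightedMeasure ω (T k) ≤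
      ENNReal.ofReal (A * u ^ η) * ENNReal.ofReal q ^ k := by
    have h1 := hwc x₀ r hr (T k) (hTm k) inter_subset_right
    rw [ENNReal.div_eq_inv_mul] at h1
    refine h1.trans ?_
    have h2 : (volume (T k) / volume Q) ^ δ ≤ ENNReal.ofReal q ^ k := by
      have h3 : volume (T k) / volume Q ≤ 2⁻¹ ^ k := ENNReal.div_le_of_le_mul (hTv k)
      refine (ENNReal.rpow_le_rpow h3 hδ.le).trans (le_of_eq ?_)
      rw [hq, ← ENNReal.ofReal_rpow_of_pos (by norm_num), ENNReal.ofReal_inv_of_pos (by norm_num),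
        ENNReal.ofReal_ofNat, ← ENNReal.rpow_natCast, ← ENNReal.rpow_mul, ← ENNReal.rpow_natCast,
        ← ENNReal.rpow_mul, mul_comm]
    calc _ ≤ ENNReal.ofReal A * ENNReal.ofReal q ^ k * ENNReal.ofReal (u ^ η) := by gcongr
      _ = _ := by rw [ENNReal.ofReal_mul hA.le]; ring
  have hpt : ∫⁻ x in Q, h x ^ p * ENNReal.ofReal (ω x) ≤
      ∑' k : ℕ, (((k : ℝ≥0∞) + 1) * b) ^ p * weightedMeasure ω (T k) := by
    calc ∫⁻ x in Q, h x ^ p * ENNReal.ofReal (ω x)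
        ≤ ∫⁻ x in Q, ∑' k : ℕ, (((k : ℝ≥0∞) + 1) * b) ^ p *
            (T k).indicator (fun x => ENNReal.ofReal (ω x)) x := by
          refine setLIntegral_mono' hQm fun x hx => ?_
          refine (mul_le_mul_left (rpow_le_tsum_indicator hp0 hb0 (T := T) (x := x)
            (by rw [hh, hm]; exact ENNReal.ofReal_ne_top)
            fun k hk => ⟨subset_toMeasurable _ _ ⟨hx, hk⟩, hx⟩) _).trans (le_of_eq ?_)
          rw [← ENNReal.tsum_mul_right]
          refine tsum_congr fun k => ?_
          by_cases hxT : x ∈ T k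
          · rw [indicator_of_mem hxT, indicator_of_mem hxT, mul_one]
          · rw [indicator_of_notMem hxT, indicator_of_notMem hxT, mul_zero, zero_mul]
      _ = ∑' k : ℕ, (((k : ℝ≥0∞) + 1) * b) ^ p * weightedMeasure ω (T k) := by
          rw [lintegral_tsum fun k => ((hωm.indicator (hTm k)).const_mul _).restrict]
          refine tsum_congr fun k => ?_
          rw [lintegral_const_mul'' _ (hωm.indicator (hTm k)).restrict,
            lintegral_indicator (hTm k), Measure.restrict_restrict (hTm k),
            inter_eq_self_of_subset_left inter_subset_right]
          rfl
  have hJ : (weightedMeasure ω Q)⁻¹ * ∫⁻ x in Q, h x ^ p * ENNReal.ofReal (ω x) ≤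
      b ^ p * ENNReal.ofReal (A * u ^ η * σ) := by
    calc _ ≤ (weightedMeasure ω Q)⁻¹ *
          ∑' k : ℕ, (((k : ℝ≥0∞) + 1) * b) ^ p * weightedMeasure ω (T k) := by gcongr
      _ = ∑' k : ℕ, (((k : ℝ≥0∞) + 1) * b) ^ p *
            ((weightedMeasure ω Q)⁻¹ * weightedMeasure ω (T k)) := by
          rw [← ENNReal.tsum_mul_left]
          exact tsum_congr fun k => by ring
      _ ≤ ∑' k : ℕ, (((k : ℝ≥0∞) + 1) * b) ^ p *
            (ENNReal.ofReal (A * u ^ η) * ENNReal.ofReal q ^ k) :=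
          ENNReal.tsum_le_tsum fun k => mul_le_mul_right (hTw k) _
      _ = b ^ p * ENNReal.ofReal (A * u ^ η) *
            ∑' k : ℕ, ((k : ℝ≥0∞) + 1) ^ p * ENNReal.ofReal q ^ k := by
          rw [← ENNReal.tsum_mul_left]
          refine tsum_congr fun k => ?_
          rw [ENNReal.mul_rpow_of_nonneg _ _ hp0.le]
          ring
      _ = _ := by rw [hσE, mul_assoc, ← ENNReal.ofReal_mul (by positivity)]
  have hfin : weightedLowerOsc p ω f Q ≤ b * ENNReal.ofReal ((A * u ^ η * σ) ^ (1 / p)) := by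
    refine (ENNReal.rpow_le_rpow hJ (by positivity)).trans (le_of_eq ?_)
    rw [ENNReal.mul_rpow_of_nonneg _ _ (by positivity), ← ENNReal.rpow_mul,
      mul_one_div_cancel hp0.ne', ENNReal.rpow_one, ENNReal.ofReal_rpow_of_pos (by positivity)]
  refine hfin.trans ?_
  have e1 : (A * u ^ η * σ) ^ (1 / p) = (A * σ) ^ (1 / p) * u ^ (η / p) := by
    rw [show A * u ^ η * σ = (A * σ) * u ^ η by ring, Real.mul_rpow (by positivity) (by positivity),
      ← Real.rpow_mul hu0.le, mul_one_div]
  have e2 : (2 : ℝ≥0∞) ^ (d + 1) = ENNReal.ofReal (2 ^ (d + 1)) := by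
    rw [ENNReal.ofReal_pow (by norm_num), ENNReal.ofReal_ofNat]
  calc b * ENNReal.ofReal ((A * u ^ η * σ) ^ (1 / p))
      = ENNReal.ofReal (2 ^ (d + 1) * c * (A * σ) ^ (1 / p)) * 1 *
          ENNReal.ofReal (u ^ ((N₀ + 1) * θ₁ + η / p)) * N := by
        rw [e1, hb, hL, e2, Real.rpow_add hu0, ENNReal.ofReal_mul (by positivity),
          ENNReal.ofReal_mul (q := (A * σ) ^ (1 / p)) (by positivity),
          ENNReal.ofReal_mul (p := 2 ^ (d + 1)) (by positivity),
          ENNReal.ofReal_mul (q := u ^ (η / p)) (by positivity),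
          ENNReal.ofReal_mul (q := u ^ (η / p)) (by positivity)]
        ring
    _ ≤ ENNReal.ofReal (2 ^ (d + 1) * c * (A * σ) ^ (1 / p)) *
          (ENNReal.ofReal (2 ^ θ₂) * apConst p ρ θ₂ ω) *
          ENNReal.ofReal (u ^ ((N₀ + 1) * θ₁ + η / p)) * N := by
        gcongr
        exact one_le_apConst hp hρ hω
    _ = _ := by
        rw [ENNReal.ofReal_mul (q := 2 ^ θ₂) (by positivity)]
        ring

/-! ### Power growth and slowly varying radii -/

/-- Iterate as long as M^n r ≤ R. The exponent is fixed by M^(log_M β) = β, and the remaining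
fraction of a step costs β⁻¹. -/
theorem le_rpow_mul_of_le_mul {f : ℝ → ℝ} (hf0 : ∀ r, 0 < r → 0 ≤ f r)
    (hf : ∀ r s, 0 < r → r ≤ s → f r ≤ f s) {β M : ℝ} (hβ0 : 0 < β) (hβ1 : β < 1) (hM : 1 < M)
    (h : ∀ r, 0 < r → f r ≤ β * f (M * r)) {r R : ℝ} (hr : 0 < r) (hrR : r ≤ R) :
    f r ≤ β⁻¹ * (r / R) ^ (-Real.logb M β) * f R := by
  have hM0 : 0 < M := by linarith
  have hR : 0 < R := hr.trans_le hrR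
  have hit (n : ℕ) : f r ≤ β ^ n * f (M ^ n * r) := by
    induction n with
    | zero => simp
    | succ n ih =>
      refine ih.trans ?_
      rw [pow_succ, mul_assoc (β ^ n), pow_succ' M, mul_assoc M]
      gcongr
      exact h _ (by positivity)
  obtain ⟨n, hn1, hn2⟩ := exists_nat_pow_near ((one_le_div hr).2 hrR) hM
  have h1 : f (M ^ n * r) ≤ f R := hf _ _ (by positivity) ((le_div_iff₀ hr).1 hn1)
  have hlog : 0 < -Real.logb M β := neg_pos.2 (Real.logb_neg hM hβ0 hβ1)
  have h2 : β ^ (n + 1) ≤ (r / R) ^ (-Real.logb M β) := by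
    have h3 : β ^ (n + 1) = ((M ^ (n + 1))⁻¹) ^ (-Real.logb M β) := by
      rw [Real.inv_rpow (by positivity), ← Real.rpow_neg (by positivity), neg_neg,
        ← Real.rpow_natCast M, ← Real.rpow_mul hM0.le, mul_comm, Real.rpow_mul hM0.le,
        Real.rpow_logb hM0 hM.ne' hβ0, Real.rpow_natCast]
    rw [h3]
    refine Real.rpow_le_rpow (by positivity) ?_ hlog.le
    rw [← inv_div R r]
    gcongr
  calc f r ≤ β ^ n * f (M ^ n * r) := hit n
    _ ≤ β ^ n * f R := by gcongr
    _ = β⁻¹ * β ^ (n + 1) * f R := by rw [pow_succ]; field_simp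
    _ ≤ _ := by gcongr; exact hf0 R hR

theorem le_rpow_mul_of_mul_le {f : ℝ → ℝ} (hf0 : ∀ r, 0 < r → 0 ≤ f r)
    (hf : ∀ r s, 0 < r → r ≤ s → f r ≤ f s) {b M : ℝ} (hb : 1 < b) (hM : 1 < M)
    (h : ∀ r, 0 < r → f (M * r) ≤ b * f r) {r R : ℝ} (hr : 0 < r) (hrR : r ≤ R) :
    f R ≤ b * (R / r) ^ Real.logb M b * f r := by
  have hM0 : 0 < M := by linarith
  have hb0 : 0 < b := by linarith
  have hR : 0 < R := hr.trans_le hrR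
  have hit (n : ℕ) : f (M ^ n * r) ≤ b ^ n * f r := by
    induction n with
    | zero => simp
    | succ n ih =>
      rw [pow_succ' M, mul_assoc M, pow_succ' b, mul_assoc]
      exact (h _ (by positivity)).trans (by gcongr)
  obtain ⟨n, hn1, hn2⟩ := exists_nat_pow_near ((one_le_div hr).2 hrR) hM
  have h1 : f R ≤ f (M ^ (n + 1) * r) := hf _ _ hR ((div_le_iff₀ hr).1 hn2.le)
  have h2 : b ^ n ≤ (R / r) ^ Real.logb M b := by
    have h3 : b ^ n = (M ^ n) ^ Real.logb M b := by
      rw [← Real.rpow_natCast M, ← Real.rpow_mul hM0.le, mul_comm, Real.rpow_mul hM0.le,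
        Real.rpow_logb hM0 hM.ne' hb0, Real.rpow_natCast]
    rw [h3]
    exact Real.rpow_le_rpow (by positivity) hn1 (Real.logb_pos hM hb).le
  calc f R ≤ f (M ^ (n + 1) * r) := h1
    _ ≤ b ^ (n + 1) * f r := hit _
    _ = b * b ^ n * f r := by rw [pow_succ']
    _ ≤ _ := by gcongr; exact hf0 r hr

/-- The upper bound is the lower bound with the points exchanged, which is implicit in a =
ρ(y)/ρ(x): a ≤ C(1 + (u-1)/a)^N. For a ≤ u it gives a^(N+1) ≤ C 2^N u^N, hence the exponent N/(N+1);
for a ≥ u it gives a ≤ C 2^N. -/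
theorem radiusComparison_of_lower {ρ : E d → ℝ} (hρ : ∀ x, 0 < ρ x) {C N : ℝ} (hC : 1 ≤ C)
    (hN : 0 < N) (h : ∀ x y, ρ x ≤ C * (1 + ‖x - y‖ / ρ x) ^ N * ρ y) :
    RadiusComparison ρ (C * 2 ^ N) N := by
  have h2N : (1 : ℝ) ≤ 2 ^ N := Real.one_le_rpow (by norm_num) hN.le
  intro x y
  have hx := hρ x
  have hy := hρ y
  set u : ℝ := 1 + ‖x - y‖ / ρ x with hu
  have hu1 : 1 ≤ u := by rw [hu]; have : 0 ≤ ‖x - y‖ / ρ x := by positivity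
                         linarith
  have hu0 : 0 < u := by linarith
  set a : ℝ := ρ y / ρ x with ha
  have ha0 : 0 < a := by positivity
  constructor
  · have h1 : 1 ≤ C * u ^ N * a := by
      rw [ha, ← mul_div_assoc, one_le_div hx]
      exact h x y
    rw [Real.rpow_neg hu0.le, one_div, ← mul_inv, inv_le_iff_one_le_mul₀' (by positivity)]
    calc 1 ≤ C * u ^ N * a := h1
      _ ≤ C * u ^ N * a * 2 ^ N := le_mul_of_one_le_right (by positivity) h2N
      _ = _ := by ring
  · have h1 : a ≤ C * (1 + (u - 1) / a) ^ N := by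
      have := h y x
      rw [norm_sub_rev] at this
      rw [ha, div_le_iff₀ hx]
      convert! this using 4
      rw [hu]; field_simp; ring
    have hun : 1 ≤ u ^ (N / (N + 1)) := Real.one_le_rpow hu1 (by positivity)
    have hC2 : 1 ≤ C * 2 ^ N := one_le_mul_of_one_le_of_one_le hC h2N
    rcases le_total u a with hua | hau
    · have h3 : (u - 1) / a ≤ 1 := (div_le_one ha0).2 (by linarith)
      have h4 : 0 ≤ (u - 1) / a := div_nonneg (by linarith) ha0.le
      calc a ≤ C * (1 + (u - 1) / a) ^ N := h1
        _ ≤ C * 2 ^ N := by gcongr; linarith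
        _ ≤ _ := le_mul_of_one_le_right (by positivity) hun
    · have h3 : 1 + (u - 1) / a ≤ 2 * u / a := by
        rw [le_div_iff₀ ha0, add_mul, div_mul_cancel₀ _ ha0.ne']; linarith
      have h4 : 0 ≤ (u - 1) / a := div_nonneg (by linarith) ha0.le
      have h5 : a ^ (N + 1) ≤ C * 2 ^ N * u ^ N := by
        rw [Real.rpow_add ha0, Real.rpow_one]
        calc a ^ N * a ≤ a ^ N * (C * (2 * u / a) ^ N) := by
              gcongr
              exact h1.trans (by gcongr)
          _ = C * 2 ^ N * u ^ N := by
              rw [Real.div_rpow (by positivity) ha0.le, Real.mul_rpow (by norm_num) hu0.le]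
              field_simp
      have hN1 : 0 < N + 1 := by linarith
      calc a = (a ^ (N + 1)) ^ (1 / (N + 1)) := by
            rw [← Real.rpow_mul ha0.le, mul_one_div_cancel hN1.ne', Real.rpow_one]
        _ ≤ (C * 2 ^ N * u ^ N) ^ (1 / (N + 1)) :=
            Real.rpow_le_rpow (by positivity) h5 (by positivity)
        _ = (C * 2 ^ N) ^ (1 / (N + 1)) * u ^ (N / (N + 1)) := by
            rw [Real.mul_rpow (by positivity) (by positivity), ← Real.rpow_mul hu0.le, mul_one_div]
        _ ≤ C * 2 ^ N * u ^ (N / (N + 1)) := by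
            gcongr
            nth_rw 2 [← Real.rpow_one (C * 2 ^ N)]
            refine Real.rpow_le_rpow_of_exponent_le hC2 ?_
            rw [div_le_one hN1]; linarith

/-- A critical radius defined by a scale-invariant quantity `φ` with power growth is positive and
slowly varying. -/
theorem exists_radiusComparison_of_growth {φ : E d → ℝ → ℝ} {C ε k : ℝ} {j : ℕ} (hC : 1 ≤ C)
    (hε : 0 < ε) (hεk : ε < k) (hpos : ∀ x r, 0 < r → 0 < φ x r)
    (hdecay : ∀ x r R, 0 < r → r ≤ R → φ x r ≤ C * (r / R) ^ ε * φ x R)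
    (hgrow : ∀ x r R, 0 < r → r ≤ R → φ x R ≤ C * (R / r) ^ k * φ x r)
    (hincl : ∀ x y T, 0 < T → ‖x - y‖ ≤ T → φ y T ≤ 2 ^ j * φ x (2 * T))
    {ρ : E d → ℝ} (hρ : ∀ x, ρ x = sSup {r | 0 < r ∧ φ x r ≤ 1}) :
    (∀ x, 0 < ρ x) ∧ ∃ C₀ N₀ : ℝ, 1 ≤ C₀ ∧ 0 < N₀ ∧ RadiusComparison ρ C₀ N₀ := by
  have hC0 : 0 < C := by linarith
  have hk : 0 < k := hε.trans hεk
  -- a scale at which a bound of power type forces `φ ≤ 1`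
  have hsolve {D T : ℝ} (hD : 1 ≤ D) (hT : 0 < T) (y : E d)
      (hb : ∀ r, 0 < r → r ≤ T → φ y r ≤ D * (r / T) ^ ε) :
      T * D ^ (-(1 / ε)) ∈ {r | 0 < r ∧ φ y r ≤ 1} := by
    have hD0 : 0 < D := by linarith
    have h0 : 0 < T * D ^ (-(1 / ε)) := by positivity
    refine ⟨h0, (hb _ h0 ?_).trans (le_of_eq ?_)⟩
    · refine mul_le_of_le_one_right hT.le (Real.rpow_le_one_of_one_le_of_nonpos hD ?_)
      have : 0 < 1 / ε := by positivity
      linarith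
    · rw [mul_div_cancel_left₀ _ hT.ne', ← Real.rpow_mul hD0.le, neg_mul,
        one_div_mul_cancel hε.ne', Real.rpow_neg_one, mul_inv_cancel₀ hD0.ne']
  have hne (x : E d) : {r | 0 < r ∧ φ x r ≤ 1}.Nonempty := by
    refine ⟨_, hsolve (D := max 1 (C * φ x 1)) (le_max_left _ _) one_pos x fun r hr hr1 => ?_⟩
    calc φ x r ≤ C * (r / 1) ^ ε * φ x 1 := hdecay x r 1 hr hr1
      _ = C * φ x 1 * (r / 1) ^ ε := by ring
      _ ≤ _ := by gcongr; exact le_max_right _ _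
  -- By `hdecay` from radius 1 to r, φ(x,r) is at least a positive multiple of r^ε, so it stays at
  -- most 1 only on a bounded range.
  have hbdd (x : E d) : BddAbove {r | 0 < r ∧ φ x r ≤ 1} := by
    have hx := hpos x 1 one_pos
    refine ⟨max 1 ((C / φ x 1) ^ (1 / ε)), fun r ⟨hr, hr1⟩ => ?_⟩
    rcases le_total r 1 with h | h
    · exact h.trans (le_max_left _ _)
    refine le_trans ?_ (le_max_right _ _)
    have h1 := hdecay x 1 r one_pos h
    have h2 : r ^ ε ≤ C / φ x 1 := by
      rw [le_div_iff₀ hx]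
      calc r ^ ε * φ x 1 ≤ r ^ ε * (C * (1 / r) ^ ε * 1) := by
            gcongr
            exact h1.trans (by gcongr)
        _ = C := by
            rw [Real.div_rpow zero_le_one hr.le, Real.one_rpow]; field_simp
    calc r = (r ^ ε) ^ (1 / ε) := by
          rw [← Real.rpow_mul hr.le, mul_one_div_cancel hε.ne', Real.rpow_one]
      _ ≤ _ := Real.rpow_le_rpow (by positivity) h2 (by positivity)
  have hρpos (x : E d) : 0 < ρ x := by
    obtain ⟨r, hr⟩ := hne x
    rw [hρ]
    exact hr.1.trans_le (le_csSup (hbdd x) hr)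
  refine ⟨hρpos, ?_⟩
  set D : ℝ := C * 2 ^ j * C * 4 ^ k with hD
  have hD1 : 1 ≤ D := one_le_mul_of_one_le_of_one_le (one_le_mul_of_one_le_of_one_le
    (one_le_mul_of_one_le_of_one_le hC (one_le_pow₀ (by norm_num))) hC)
    (Real.one_le_rpow (by norm_num) hk.le)
  have hD0 : 0 < D := by linarith
  have hN : 0 < k / ε - 1 := by
    rw [sub_pos, one_lt_div hε]; exact hεk
  refine ⟨_, _, ?_, hN, radiusComparison_of_lower hρpos
    (C := D ^ (1 / ε)) (Real.one_le_rpow hD1 (by positivity)) hN ?_⟩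
  · exact one_le_mul_of_one_le_of_one_le (Real.one_le_rpow hD1 (by positivity))
      (Real.one_le_rpow (by norm_num) hN.le)
  intro x y
  have hx := hρpos x
  set T : ℝ := ρ x + ‖x - y‖ with hT
  have hT0 : 0 < T := by positivity
  set u : ℝ := 1 + ‖x - y‖ / ρ x with hu
  have huT : T = ρ x * u := by rw [hT, hu]; field_simp
  have hu1 : 1 ≤ u := by rw [hu]; have : 0 ≤ ‖x - y‖ / ρ x := by positivity
                         linarith
  have hu0 : 0 < u := by linarith
  -- The supremum need not be attained, so an admissible s > ρ(x)/2 replaces ρ(x); this gives 2T/s ≤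
  -- 4u and the factor 4^k in D.
  obtain ⟨s, ⟨hs0, hs1⟩, hs⟩ := exists_lt_of_lt_csSup (hne x)
    (show ρ x / 2 < sSup {r | 0 < r ∧ φ x r ≤ 1} by rw [← hρ]; linarith)
  have hsρ : s ≤ ρ x := by rw [hρ]; exact le_csSup (hbdd x) ⟨hs0, hs1⟩
  have hsT : s ≤ 2 * T := by rw [hT]; linarith [norm_nonneg (x - y)]
  have hφs := (hpos x s hs0).le
  have hφT : φ y T ≤ 2 ^ j * (C * (4 ^ k * u ^ k)) := by
    have h1 : 2 * T / s ≤ 4 * u := by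
      rw [div_le_iff₀ hs0, huT]
      nlinarith
    calc φ y T ≤ 2 ^ j * φ x (2 * T) := hincl x y T hT0 (by rw [hT]; linarith)
      _ ≤ 2 ^ j * (C * (2 * T / s) ^ k * φ x s) := by gcongr; exact hgrow x s _ hs0 hsT
      _ ≤ 2 ^ j * (C * (4 * u) ^ k * 1) := by gcongr
      _ = _ := by rw [mul_one, Real.mul_rpow (by norm_num) hu0.le]
  -- Consequently ρ(y) ≥ T (D u^k)^(-1/ε) with T = u ρ(x), which is the lower comparison with N =
  -- k/ε - 1.
  have hmem := hsolve (D := D * u ^ k) (one_le_mul_of_one_le_of_one_le hD1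
    (Real.one_le_rpow hu1 hk.le)) hT0 y fun r hr hrT => by
      calc φ y r ≤ C * (r / T) ^ ε * φ y T := hdecay y r T hr hrT
        _ ≤ C * (r / T) ^ ε * (2 ^ j * (C * (4 ^ k * u ^ k))) := by gcongr
        _ = _ := by rw [hD]; ring
  have hle := le_csSup (hbdd y) hmem
  rw [← hρ, Real.mul_rpow hD0.le (by positivity), ← Real.rpow_mul hu0.le, huT,
    Real.rpow_neg hD0.le] at hle
  calc ρ x = D ^ (1 / ε) * u ^ (k / ε - 1) *
        (ρ x * u * ((D ^ (1 / ε))⁻¹ * u ^ (k * -(1 / ε)))) := by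
        have e : u ^ (k / ε - 1) * (u * u ^ (k * -(1 / ε))) = 1 := by
          nth_rw 2 [← Real.rpow_one u]
          rw [← Real.rpow_add hu0, ← Real.rpow_add hu0]
          rw [show k / ε - 1 + (1 + k * -(1 / ε)) = 0 by ring, Real.rpow_zero]
        have hDp : D ^ (1 / ε) ≠ 0 := by positivity
        calc ρ x = (D ^ (1 / ε) * (D ^ (1 / ε))⁻¹) *
              (u ^ (k / ε - 1) * (u * u ^ (k * -(1 / ε)))) * ρ x := by
              rw [e, mul_inv_cancel₀ hDp]; ring
          _ = _ := by ring
    _ ≤ _ := by gcongr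

/-! ### Reverse Hölder potentials -/

/-- The measure with density `V`. -/
noncomputable def potentialMeasure (V : E d → ℝ) : Measure (E d) :=
  volume.withDensity fun x => ENNReal.ofReal (V x)

/-- The measure with density `V ^ q`. -/
noncomputable def powerMeasure (q : ℝ) (V : E d → ℝ) : Measure (E d) :=
  volume.withDensity fun x => ENNReal.ofReal (V x) ^ q

/-- On a probability measure the norms increase with the exponent, so s, possibly ∞, can be lowered
to a finite q. -/
theorem ReverseHolder.lintegral_rpow_le {s : ℝ≥0∞} {V : E d → ℝ} (hV : ReverseHolder s V)
    (hV0 : ∀ x, 0 ≤ V x) (hVm : AEStronglyMeasurable V) {q : ℝ} (hq : 0 < q)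
    (hqs : ENNReal.ofReal q ≤ s) :
    ∃ C : ℝ, 1 ≤ C ∧ ∀ (x : E d) (r : ℝ), 0 < r →
      powerMeasure q V (Metric.ball x r) ^ (1 / q) ≤ ENNReal.ofReal C *
        volume (Metric.ball x r) ^ (1 / q - 1) * potentialMeasure V (Metric.ball x r) := by
  obtain ⟨C, hC, h⟩ := hV
  refine ⟨max 1 C, le_max_left _ _, fun x r hr => ?_⟩
  set B := Metric.ball x r with hB
  have hBm : MeasurableSet B := Metric.isOpen_ball.measurableSet
  have hB0 : volume B ≠ 0 := (Metric.measure_ball_pos _ _ hr).ne'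
  have hBt : volume B ≠ ∞ := measure_ball_lt_top.ne
  set ν := (volume B)⁻¹ • volume.restrict B with hν
  have hνp : IsProbabilityMeasure ν := ⟨by
    rw [hν, Measure.smul_apply, Measure.restrict_apply_univ, smul_eq_mul,
      ENNReal.inv_mul_cancel hB0 hBt]⟩
  have hVν : AEStronglyMeasurable V ν := hVm.restrict.smul_measure _
  have h1 := (eLpNorm_le_eLpNorm_of_exponent_le hqs hVν).trans (h x r hr)
  have hen (y : E d) : ‖V y‖ₑ = ENNReal.ofReal (V y) := Real.enorm_of_nonneg (hV0 y)
  rw [eLpNorm_eq_lintegral_rpow_enorm_toReal (by simpa using hq) ENNReal.ofReal_ne_top,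
    eLpNorm_one_eq_lintegral_enorm, ENNReal.toReal_ofReal hq.le, lintegral_smul_measure,
    lintegral_smul_measure] at h1
  simp only [hen, smul_eq_mul] at h1
  rw [← withDensity_apply _ hBm, ← withDensity_apply _ hBm] at h1
  change ((volume B)⁻¹ * powerMeasure q V B) ^ (1 / q) ≤
    ENNReal.ofReal C * ((volume B)⁻¹ * potentialMeasure V B) at h1
  rw [ENNReal.mul_rpow_of_nonneg _ _ (by positivity), ENNReal.inv_rpow,
    ENNReal.inv_mul_le_iff (by simp [hB0, hBt])
      (ENNReal.rpow_ne_top_of_nonneg (by positivity) hBt)] at h1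
  refine h1.trans ?_
  rw [ENNReal.rpow_sub _ _ hB0 hBt, ENNReal.rpow_one, div_eq_mul_inv (_ ^ _)]
  calc volume B ^ (1 / q) * (ENNReal.ofReal C * ((volume B)⁻¹ * potentialMeasure V B))
      = ENNReal.ofReal C * (volume B ^ (1 / q) * (volume B)⁻¹) * potentialMeasure V B := by ring
    _ ≤ _ := by gcongr; exact le_max_right _ _

theorem potentialMeasure_ball_ne_top {V : E d → ℝ} (hV : LocallyIntegrable V) (x : E d) (r : ℝ) :
    potentialMeasure V (Metric.ball x r) ≠ ∞ := by
  rw [potentialMeasure, ← weightedMeasure_eq_withDensity V Metric.isOpen_ball.measurableSet]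
  exact weightedMeasure_ne_top hV (isCompact_closedBall x r) Metric.ball_subset_closedBall

/-- Hölder's inequality between the measures with densities `V` and `V ^ q`. -/
theorem potentialMeasure_le {V : E d → ℝ} (hVm : AEMeasurable V) {q : ℝ} (hq : 1 < q)
    {S : Set (E d)} (hS : MeasurableSet S) :
    potentialMeasure V S ≤ powerMeasure q V S ^ (1 / q) * volume S ^ (1 - 1 / q) := by
  have hpq : q.HolderConjugate (q / (q - 1)) := Real.HolderConjugate.conjExponent hq
  have h := ENNReal.lintegral_mul_le_Lp_mul_Lq (volume.restrict S) hpq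
    hVm.ennreal_ofReal.restrict (aemeasurable_const (b := (1 : ℝ≥0∞)))
  simp only [Pi.mul_apply, mul_one, ENNReal.one_rpow, lintegral_const,
    Measure.restrict_apply_univ, one_mul] at h
  rw [potentialMeasure, powerMeasure, withDensity_apply _ hS, withDensity_apply _ hS]
  have e : 1 - 1 / q = 1 / (q / (q - 1)) := by
    rw [one_div_div, sub_div, div_self (by linarith)]
  rw [e]
  exact h

theorem volume_real_ball (x : E d) {r : ℝ} (hr : 0 < r) :
    volume.real (Metric.ball x r) = r ^ d * volume.real (Metric.ball (0 : E d) 1) := by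
  have h := Measure.addHaar_ball_of_pos (volume : Measure (E d)) x hr
  rw [measureReal_def, h, ENNReal.toReal_mul, ENNReal.toReal_ofReal (by positivity)]
  simp [measureReal_def]

/-- The consequences of a reverse Hölder inequality for the two measures `μ` and `W` that are used
below: the inequality itself and Hölder's inequality, in terms of real numbers. -/
structure HolderPair (q C : ℝ) (μ W : Measure (E d)) : Prop where
  one_lt : 1 < q
  one_le : 1 ≤ C
  ne_top : ∀ (x : E d) (r : ℝ), μ (Metric.ball x r) ≠ ∞
  ne_top' : ∀ (x : E d) (r : ℝ), W (Metric.ball x r) ≠ ∞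
  holder : ∀ (x : E d) (r : ℝ) (S : Set (E d)), MeasurableSet S → S ⊆ Metric.ball x r →
    μ.real S ≤ W.real S ^ (1 / q) * volume.real S ^ (1 - 1 / q)
  reverse : ∀ (x : E d) (r : ℝ), 0 < r → W.real (Metric.ball x r) ^ (1 / q) ≤
    C * volume.real (Metric.ball x r) ^ (1 / q - 1) * μ.real (Metric.ball x r)

theorem exists_holderPair {s : ℝ≥0∞} {V : E d → ℝ} (hV : ReverseHolder s V)
    (hV0 : ∀ x, 0 ≤ V x) (hVi : LocallyIntegrable V) {q : ℝ} (hq : 1 < q)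
    (hqs : ENNReal.ofReal q ≤ s) :
    ∃ C : ℝ, HolderPair q C (potentialMeasure V) (powerMeasure q V) := by
  have hq0 : 0 < q := by linarith
  obtain ⟨C, hC1, hC⟩ := hV.lintegral_rpow_le hV0 hVi.aestronglyMeasurable hq0 hqs
  -- Local integrability of V^q is not assumed; the reverse Hölder inequality supplies it.
  have hWt (x : E d) (r : ℝ) : powerMeasure q V (Metric.ball x r) ≠ ∞ := by
    rcases le_or_gt r 0 with hr | hr
    · simp [Metric.ball_eq_empty.2 hr]
    have h1 : powerMeasure q V (Metric.ball x r) ^ (1 / q) < ∞ := by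
      refine (hC x r hr).trans_lt (ENNReal.mul_lt_top (ENNReal.mul_lt_top ENNReal.ofReal_lt_top ?_)
        (potentialMeasure_ball_ne_top hVi x r).lt_top)
      exact (ENNReal.rpow_ne_top_of_ne_zero (Metric.measure_ball_pos _ _ hr).ne'
        measure_ball_lt_top.ne).lt_top
    exact ((ENNReal.rpow_lt_top_iff_of_pos (by positivity)).1 h1).ne
  refine ⟨C, hq, hC1, potentialMeasure_ball_ne_top hVi, hWt, fun x r S hS hSB => ?_,
    fun x r hr => ?_⟩
  · have h := potentialMeasure_le (V := V) hVi.aestronglyMeasurable.aemeasurable hq hS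
    have h1 : (0 : ℝ) ≤ 1 - 1 / q := by
      rw [sub_nonneg, div_le_one hq0]; exact hq.le
    have := ENNReal.toReal_mono (ENNReal.mul_ne_top
      (ENNReal.rpow_ne_top_of_nonneg (by positivity)
        ((measure_mono hSB).trans_lt (hWt x r).lt_top).ne)
      (ENNReal.rpow_ne_top_of_nonneg h1
        ((measure_mono hSB).trans_lt measure_ball_lt_top).ne)) h
    rwa [ENNReal.toReal_mul, ← ENNReal.toReal_rpow, ← ENNReal.toReal_rpow] at this
  · have := ENNReal.toReal_mono (ENNReal.mul_ne_top (ENNReal.mul_ne_top ENNReal.ofReal_ne_top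
      (ENNReal.rpow_ne_top_of_ne_zero (Metric.measure_ball_pos _ _ hr).ne'
        measure_ball_lt_top.ne)) (potentialMeasure_ball_ne_top hVi x r)) (hC x r hr)
    rwa [ENNReal.toReal_mul, ENNReal.toReal_mul, ← ENNReal.toReal_rpow, ← ENNReal.toReal_rpow,
      ENNReal.toReal_ofReal (by linarith)] at this

namespace HolderPair

variable {q C : ℝ} {μ W : Measure (E d)}

/-- Hölder on S, then W(S) ≤ W(B), then reverse Hölder on B: a set of small relative volume has
small relative μ-mass. -/
theorem real_le (h : HolderPair q C μ W) {x : E d} {r : ℝ} (hr : 0 < r) {S : Set (E d)}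
    (hS : MeasurableSet S) (hSB : S ⊆ Metric.ball x r) :
    μ.real S ≤ C * (volume.real S / volume.real (Metric.ball x r)) ^ (1 - 1 / q) *
      μ.real (Metric.ball x r) := by
  have hq0 : 0 < q := by linarith [h.one_lt]
  have hv : 0 < volume.real (Metric.ball x r) :=
    ENNReal.toReal_pos (Metric.measure_ball_pos _ _ hr).ne' measure_ball_lt_top.ne
  calc μ.real S ≤ W.real S ^ (1 / q) * volume.real S ^ (1 - 1 / q) := h.holder x r S hS hSB
    _ ≤ W.real (Metric.ball x r) ^ (1 / q) * volume.real S ^ (1 - 1 / q) := by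
        gcongr
        exact h.ne_top' x r
    _ ≤ (C * volume.real (Metric.ball x r) ^ (1 / q - 1) * μ.real (Metric.ball x r)) *
          volume.real S ^ (1 - 1 / q) := by gcongr; exact h.reverse x r hr
    _ = _ := by
        rw [Real.div_rpow (by positivity) hv.le, ← neg_sub 1 (1 / q), Real.rpow_neg hv.le]
        ring

/-- For M close to 1 the shell between the balls has small relative volume, hence at most half of
the μ-mass of the larger ball. -/
theorem exists_doubling (h : HolderPair q C μ W) :
    ∃ M : ℝ, 1 < M ∧ ∀ (x : E d) (r : ℝ), 0 < r →
      μ.real (Metric.ball x (M * r)) ≤ 2 * μ.real (Metric.ball x r) := by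
  have hq0 : 0 < q := by linarith [h.one_lt]
  have hC := h.one_le
  have hq1 : 0 < 1 - 1 / q := by rw [sub_pos, div_lt_one hq0]; exact h.one_lt
  have hlim : Tendsto (fun M : ℝ => C * (1 - (M ^ d)⁻¹) ^ (1 - 1 / q)) (𝓝 1) (𝓝 0) := by
    have hc : ContinuousAt (fun M : ℝ => C * (1 - (M ^ d)⁻¹) ^ (1 - 1 / q)) 1 := by
      refine ContinuousAt.mul continuousAt_const (ContinuousAt.rpow_const ?_ (Or.inr hq1.le))
      exact continuousAt_const.sub (ContinuousAt.inv₀ (by fun_prop) (by simp))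
    have := hc.tendsto
    simpa only [one_pow, inv_one, sub_self, Real.zero_rpow hq1.ne', mul_zero] using this
  have hev : ∀ᶠ M : ℝ in 𝓝[>] 1, C * (1 - (M ^ d)⁻¹) ^ (1 - 1 / q) < 1 / 2 :=
    (hlim.mono_left nhdsWithin_le_nhds).eventually_lt_const (by norm_num)
  obtain ⟨M, hM, hM1⟩ := (hev.and self_mem_nhdsWithin).exists
  have hM1 : 1 < M := hM1
  have hM0 : 0 < M := by linarith
  refine ⟨M, hM1, fun x r hr => ?_⟩
  have hsub : Metric.ball x r ⊆ Metric.ball x (M * r) :=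
    Metric.ball_subset_ball (le_mul_of_one_le_left hr.le hM1.le)
  have hm : MeasurableSet (Metric.ball x r) := Metric.isOpen_ball.measurableSet
  have h1 := h.real_le (x := x) (mul_pos hM0 hr)
    (Metric.isOpen_ball.measurableSet.diff hm) (sdiff_subset (s := Metric.ball x (M * r))
      (t := Metric.ball x r))
  rw [measureReal_sdiff hsub hm (h.ne_top x _), measureReal_sdiff hsub hm measure_ball_lt_top.ne,
    volume_real_ball x hr, volume_real_ball x (mul_pos hM0 hr)] at h1
  have hκ : 0 < volume.real (Metric.ball (0 : E d) 1) :=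
    ENNReal.toReal_pos (Metric.measure_ball_pos _ _ one_pos).ne' measure_ball_lt_top.ne
  have e : ((M * r) ^ d * volume.real (Metric.ball (0 : E d) 1) -
      r ^ d * volume.real (Metric.ball (0 : E d) 1)) /
      ((M * r) ^ d * volume.real (Metric.ball (0 : E d) 1)) = 1 - (M ^ d)⁻¹ := by
    rw [mul_pow]; field_simp
  rw [e] at h1
  have h2 : C * (1 - (M ^ d)⁻¹) ^ (1 - 1 / q) * μ.real (Metric.ball x (M * r)) ≤
      1 / 2 * μ.real (Metric.ball x (M * r)) := by gcongr
  linarith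

/-- For M large the inner ball carries at most half of μ, so the shell S carries the rest. Reverse
Hölder on the large ball followed by Hölder on S shows that S holds a fixed share of W. -/
theorem exists_reverse_doubling (h : HolderPair q C μ W) (hd : 0 < d) :
    ∃ M β : ℝ, 1 < M ∧ 0 < β ∧ β < 1 ∧ ∀ (x : E d) (r : ℝ), 0 < r →
      W.real (Metric.ball x r) ≤ β * W.real (Metric.ball x (M * r)) := by
  have hq0 : 0 < q := by linarith [h.one_lt]
  have hC := h.one_le
  have hq1 : 0 < 1 - 1 / q := by rw [sub_pos, div_lt_one hq0]; exact h.one_lt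
  have hlim : Tendsto (fun M : ℝ => C * ((M ^ d)⁻¹) ^ (1 - 1 / q)) atTop (𝓝 0) := by
    have h1 : Tendsto (fun M : ℝ => (M ^ d)⁻¹) atTop (𝓝 0) :=
      (tendsto_pow_atTop hd.ne').inv_tendsto_atTop
    have h2 := (h1.rpow_const (p := 1 - 1 / q) (Or.inr hq1.le)).const_mul C
    simpa only [one_pow, inv_one, sub_self, Real.zero_rpow hq1.ne', mul_zero] using h2
  obtain ⟨M, hM, hM1⟩ := ((hlim.eventually_lt_const (show (0 : ℝ) < 1 / 2 by norm_num)).and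
    (eventually_gt_atTop 1)).exists
  have hM0 : 0 < M := by linarith
  have hX : 2 ≤ (2 * C) ^ q := by
    calc (2 : ℝ) ≤ 2 * C := by linarith
      _ = (2 * C) ^ (1 : ℝ) := (Real.rpow_one _).symm
      _ ≤ _ := Real.rpow_le_rpow_of_exponent_le (by linarith) h.one_lt.le
  have hX' : ((2 * C) ^ q)⁻¹ ≤ 2⁻¹ := by gcongr
  have hX0 : 0 < ((2 * C) ^ q)⁻¹ := by positivity
  refine ⟨M, 1 - ((2 * C) ^ q)⁻¹, hM1, by linarith, by linarith, fun x r hr => ?_⟩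
  have hsub : Metric.ball x r ⊆ Metric.ball x (M * r) :=
    Metric.ball_subset_ball (le_mul_of_one_le_left hr.le hM1.le)
  have hm : MeasurableSet (Metric.ball x r) := Metric.isOpen_ball.measurableSet
  have hMr := mul_pos hM0 hr
  have hκ : 0 < volume.real (Metric.ball (0 : E d) 1) :=
    ENNReal.toReal_pos (Metric.measure_ball_pos _ _ one_pos).ne' measure_ball_lt_top.ne
  have hv : 0 < volume.real (Metric.ball x (M * r)) :=
    ENNReal.toReal_pos (Metric.measure_ball_pos _ _ hMr).ne' measure_ball_lt_top.ne
  have h1 := h.real_le (x := x) hMr hm hsub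
  have e : volume.real (Metric.ball x r) / volume.real (Metric.ball x (M * r)) = (M ^ d)⁻¹ := by
    rw [volume_real_ball x hr, volume_real_ball x hMr, mul_pow]; field_simp
  rw [e] at h1
  have h2 : C * ((M ^ d)⁻¹) ^ (1 - 1 / q) * μ.real (Metric.ball x (M * r)) ≤
      1 / 2 * μ.real (Metric.ball x (M * r)) := by gcongr
  set S := Metric.ball x (M * r) \ Metric.ball x r with hS
  have hSB : S ⊆ Metric.ball x (M * r) := sdiff_subset
  have hSm : MeasurableSet S := Metric.isOpen_ball.measurableSet.diff hm
  have h3 : μ.real (Metric.ball x (M * r)) ≤ 2 * μ.real S := by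
    rw [hS, measureReal_sdiff hsub hm (h.ne_top x _)]
    linarith
  have h4 : W.real (Metric.ball x (M * r)) ^ (1 / q) ≤ 2 * C * W.real S ^ (1 / q) := by
    calc W.real (Metric.ball x (M * r)) ^ (1 / q)
        ≤ C * volume.real (Metric.ball x (M * r)) ^ (1 / q - 1) *
          μ.real (Metric.ball x (M * r)) := h.reverse x _ hMr
      _ ≤ C * volume.real (Metric.ball x (M * r)) ^ (1 / q - 1) *
          (2 * (W.real S ^ (1 / q) * volume.real S ^ (1 - 1 / q))) := by
          gcongr
          exact h3.trans (by gcongr; exact h.holder x _ S hSm hSB)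
      _ ≤ C * volume.real (Metric.ball x (M * r)) ^ (1 / q - 1) *
          (2 * (W.real S ^ (1 / q) * volume.real (Metric.ball x (M * r)) ^ (1 - 1 / q))) := by
          have := measureReal_mono hSB (measure_ball_lt_top (μ := volume) (x := x)).ne
          gcongr
      _ = 2 * C * W.real S ^ (1 / q) * (volume.real (Metric.ball x (M * r)) ^ (1 / q - 1) *
          volume.real (Metric.ball x (M * r)) ^ (1 - 1 / q)) := by ring
      _ = _ := by
          rw [← Real.rpow_add hv, show 1 / q - 1 + (1 - 1 / q) = 0 by ring, Real.rpow_zero,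
            mul_one]
  have h5 : W.real (Metric.ball x (M * r)) ≤ (2 * C) ^ q * W.real S := by
    have := Real.rpow_le_rpow (by positivity) h4 hq0.le
    rwa [Real.mul_rpow (by positivity) (by positivity), ← Real.rpow_mul (by positivity),
      ← Real.rpow_mul (by positivity), one_div_mul_cancel hq0.ne', Real.rpow_one,
      Real.rpow_one] at this
  rw [hS, measureReal_sdiff hsub hm (h.ne_top' x _)] at h5
  have h6 : ((2 * C) ^ q)⁻¹ * W.real (Metric.ball x (M * r)) ≤
      W.real (Metric.ball x (M * r)) - W.real (Metric.ball x r) :=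
    (inv_mul_le_iff₀ (by positivity)).2 h5
  linarith

end HolderPair

/-! ### The critical radius of the potential -/

theorem criticalRadius_eq {V : E d → ℝ} (hV0 : ∀ x, 0 ≤ V x) (hVi : LocallyIntegrable V)
    (x : E d) : criticalRadius V x =
      sSup {r | 0 < r ∧ 1 / r ^ (d - 2) * (potentialMeasure V).real (Metric.ball x r) ≤ 1} := by
  have h (r : ℝ) : ∫ y in Metric.ball x r, V y =
      (potentialMeasure V).real (Metric.ball x r) := by
    rw [integral_eq_lintegral_of_nonneg_ae (Eventually.of_forall hV0)
      hVi.aestronglyMeasurable.restrict, measureReal_def, potentialMeasure,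
      withDensity_apply _ Metric.isOpen_ball.measurableSet]
  simp only [criticalRadius, h]

theorem criticalRadius_pos_and_exists_radiusComparison (hd : 3 ≤ d) {V : E d → ℝ}
    (hV0 : ∀ x, 0 ≤ V x) (hVi : LocallyIntegrable V) (hVne : ¬ V =ᵐ[volume] 0) {s : ℝ≥0∞}
    (hs : (d : ℝ≥0∞) / 2 ≤ s) (hV : ReverseHolder s V) :
    (∀ x, 0 < criticalRadius V x) ∧
      ∃ C₀ N₀ : ℝ, 1 ≤ C₀ ∧ 0 < N₀ ∧ RadiusComparison (criticalRadius V) C₀ N₀ := by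
  have hd3 : (3 : ℝ) ≤ d := by exact_mod_cast hd
  have hd0 : (0 : ℝ) < d := by linarith
  -- For this exponent d(1 - 1/q) = d - 2, so the volume factors in Hölder's inequality match the
  -- normalization r^(2-d).
  set q : ℝ := d / 2 with hq
  have hq1 : 1 < q := by rw [hq]; linarith
  have hq0 : 0 < q := by linarith
  obtain ⟨C, hP⟩ := exists_holderPair hV hV0 hVi hq1 (by
    rw [hq, ENNReal.ofReal_div_of_pos (by norm_num)]
    simpa using hs)
  set μ := potentialMeasure V with hμ
  set W := powerMeasure q V with hW
  obtain ⟨M, hM, hdoub⟩ := hP.exists_doubling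
  obtain ⟨M', β, hM', hβ0, hβ1, hrev⟩ := hP.exists_reverse_doubling (by omega)
  have hC := hP.one_le
  have hmono (x : E d) (r R : ℝ) (hrR : r ≤ R) :
      μ.real (Metric.ball x r) ≤ μ.real (Metric.ball x R) :=
    measureReal_mono (Metric.ball_subset_ball hrR) (hP.ne_top x R)
  have hmono' (x : E d) (r R : ℝ) (hrR : r ≤ R) :
      W.real (Metric.ball x r) ≤ W.real (Metric.ball x R) :=
    measureReal_mono (Metric.ball_subset_ball hrR) (hP.ne_top' x R)
  have hup (x : E d) {r R : ℝ} (hr : 0 < r) (hrR : r ≤ R) : μ.real (Metric.ball x R) ≤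
      2 * (R / r) ^ Real.logb M 2 * μ.real (Metric.ball x r) :=
    le_rpow_mul_of_mul_le (f := fun r => μ.real (Metric.ball x r)) (fun r _ => measureReal_nonneg)
      (fun r R _ hrR => hmono x r R hrR) one_lt_two hM (hdoub x) hr hrR
  have hdown (x : E d) {r R : ℝ} (hr : 0 < r) (hrR : r ≤ R) : W.real (Metric.ball x r) ≤
      β⁻¹ * (r / R) ^ (-Real.logb M' β) * W.real (Metric.ball x R) :=
    le_rpow_mul_of_le_mul (f := fun r => W.real (Metric.ball x r)) (fun r _ => measureReal_nonneg)
      (fun r R _ hrR => hmono' x r R hrR) hβ0 hβ1 hM' (hrev x) hr hrR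
  set k := Real.logb M 2 with hk
  have hk0 : 0 < k := Real.logb_pos hM one_lt_two
  set ε := -Real.logb M' β with hε
  have hε0 : 0 < ε := neg_pos.2 (Real.logb_neg hM' hβ0 hβ1)
  -- By doubling, a ball without mass forces all concentric balls to have none, and then V = 0
  -- almost everywhere.
  have hpos (x : E d) (r : ℝ) (hr : 0 < r) : 0 < μ.real (Metric.ball x r) := by
    refine lt_of_le_of_ne measureReal_nonneg fun h0 => hVne ?_
    have h1 : ∀ᵐ y ∂volume.restrict (⋃ n : ℕ, Metric.ball x n), V y = 0 := by
      refine (ae_restrict_iUnion_iff _ _).2 fun n => ?_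
      have h2 : μ (Metric.ball x n) = 0 := by
        have h3 := hup x hr (le_max_left r n)
        rw [← h0, mul_zero] at h3
        have h4 := le_antisymm ((hmono x n _ (le_max_right r n)).trans h3) measureReal_nonneg
        exact (measureReal_eq_zero_iff (hP.ne_top x n)).1 h4
      rw [hμ, potentialMeasure, withDensity_apply _ Metric.isOpen_ball.measurableSet,
        lintegral_eq_zero_iff'
          hVi.aestronglyMeasurable.aemeasurable.ennreal_ofReal.restrict] at h2
      filter_upwards [h2] with y hy
      exact le_antisymm (by simpa using hy) (hV0 y)
    rwa [Metric.iUnion_ball_nat, Measure.restrict_univ] at h1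
  have hκ : 0 < volume.real (Metric.ball (0 : E d) 1) :=
    ENNReal.toReal_pos (Metric.measure_ball_pos _ _ one_pos).ne' measure_ball_lt_top.ne
  set κ := volume.real (Metric.ball (0 : E d) 1) with hκ'
  have hpow {r : ℝ} (hr : 0 < r) : (r ^ d * κ) ^ (1 - 1 / q) = r ^ (d - 2) * κ ^ (1 - 1 / q) := by
    rw [Real.mul_rpow (by positivity) hκ.le, ← Real.rpow_natCast, ← Real.rpow_mul hr.le,
      ← Real.rpow_natCast, Nat.cast_sub (by omega)]
    congr 2
    rw [hq]; push_cast; field_simp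
  set φ : E d → ℝ → ℝ := fun x r => 1 / r ^ (d - 2) * μ.real (Metric.ball x r) with hφ
  set C₁ : ℝ := β⁻¹ ^ (1 / q) * C with hC₁
  have hC₁0 : 0 < C₁ := by positivity
  -- The growth exponent is enlarged from k to k + ε/q to make it strictly exceed the decay
  -- exponent; j = d - 2 comes from the ratio of (2T)^(d-2) to T^(d-2).
  refine exists_radiusComparison_of_growth (φ := φ) (C := max C₁ 2) (ε := ε / q)
    (k := k + ε / q) (j := d - 2) (one_le_two.trans (le_max_right _ _)) (by positivity)
    (by linarith) (fun x r hr => mul_pos (by positivity) (hpos x r hr)) ?_ ?_ ?_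
    (criticalRadius_eq hV0 hVi)
  · intro x r R hr hrR
    have hR : 0 < R := hr.trans_le hrR
    have h1 : φ x r ≤ W.real (Metric.ball x r) ^ (1 / q) * κ ^ (1 - 1 / q) := by
      have := hP.holder x r _ Metric.isOpen_ball.measurableSet Subset.rfl
      rw [volume_real_ball x hr, hpow hr] at this
      simp only [hφ]
      rw [one_div_mul_eq_div, div_le_iff₀ (by positivity)]
      exact this.trans (le_of_eq (by ring))
    have h2 : W.real (Metric.ball x R) ^ (1 / q) * κ ^ (1 - 1 / q) ≤ C * φ x R := by
      have := hP.reverse x R hR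
      rw [volume_real_ball x hR, ← neg_sub 1 (1 / q), Real.rpow_neg (by positivity), hpow hR] at this
      calc _ ≤ C * (R ^ (d - 2) * κ ^ (1 - 1 / q))⁻¹ * μ.real (Metric.ball x R) *
            κ ^ (1 - 1 / q) := by gcongr
        _ = C * φ x R := by
          simp only [hφ]
          have : κ ^ (1 - 1 / q) ≠ 0 := by positivity
          field_simp
    have h3 : W.real (Metric.ball x r) ^ (1 / q) ≤ β⁻¹ ^ (1 / q) * (r / R) ^ (ε / q) *
        W.real (Metric.ball x R) ^ (1 / q) := by
      refine (Real.rpow_le_rpow measureReal_nonneg (hdown x hr hrR) (by positivity)).trans ?_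
      rw [Real.mul_rpow (by positivity) measureReal_nonneg,
        Real.mul_rpow (by positivity) (by positivity), ← Real.rpow_mul (by positivity), mul_one_div]
    have hφ0 : 0 ≤ φ x R := (mul_pos (by positivity) (hpos x R hR)).le
    calc φ x r ≤ W.real (Metric.ball x r) ^ (1 / q) * κ ^ (1 - 1 / q) := h1
      _ ≤ β⁻¹ ^ (1 / q) * (r / R) ^ (ε / q) * W.real (Metric.ball x R) ^ (1 / q) *
          κ ^ (1 - 1 / q) := by gcongr
      _ = β⁻¹ ^ (1 / q) * (r / R) ^ (ε / q) * (W.real (Metric.ball x R) ^ (1 / q) *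
          κ ^ (1 - 1 / q)) := by ring
      _ ≤ β⁻¹ ^ (1 / q) * (r / R) ^ (ε / q) * (C * φ x R) := by gcongr
      _ = C₁ * (r / R) ^ (ε / q) * φ x R := by rw [hC₁]; ring
      _ ≤ _ := by gcongr; exact le_max_left _ _
  · intro x r R hr hrR
    have hR : 0 < R := hr.trans_le hrR
    have h1 : 1 ≤ R / r := (one_le_div hr).2 hrR
    have hm := (hpos x r hr).le
    calc φ x R ≤ 1 / r ^ (d - 2) * (2 * (R / r) ^ k * μ.real (Metric.ball x r)) := by
          simp only [hφ]
          gcongr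
          exact hup x hr hrR
      _ ≤ 1 / r ^ (d - 2) * (max C₁ 2 * (R / r) ^ (k + ε / q) * μ.real (Metric.ball x r)) := by
          have : (R / r) ^ k ≤ (R / r) ^ (k + ε / q) :=
            Real.rpow_le_rpow_of_exponent_le h1 (by have : 0 < ε / q := by positivity
                                                    linarith)
          gcongr
          exact le_max_right _ _
      _ = _ := by simp only [hφ]; ring
  · intro x y T hT hxy
    have hsub : Metric.ball y T ⊆ Metric.ball x (2 * T) := by
      refine Metric.ball_subset_ball' ?_
      rw [dist_comm, dist_eq_norm]
      linarith
    have h1 := measureReal_mono hsub (hP.ne_top x (2 * T))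
    calc φ y T ≤ 1 / T ^ (d - 2) * μ.real (Metric.ball x (2 * T)) := by
          simp only [hφ]
          gcongr
      _ = 2 ^ (d - 2) * φ x (2 * T) := by
          simp only [hφ]
          rw [mul_pow]; field_simp

end SchrodingerBLO

/-! ### Assembly of the theorem -/

open SchrodingerBLO in
theorem mainTheorem2 (d : ℕ) (hd : 3 ≤ d)
    (V : E d → ℝ) (hV_nonneg : ∀ x, 0 ≤ V x) (hV_int : LocallyIntegrable V volume)
    (hV_ne : ¬ (V =ᵐ[volume] 0))
    (s : ℝ≥0∞) (hs : (d : ℝ≥0∞) / 2 ≤ s) (hV : ReverseHolder s V)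
    (p θ₂ : ℝ) (hp : 1 ≤ p) (hθ₂ : 0 < θ₂) :
    -- admissible constants `C₀`, `N₀` exist
    (∃ C₀ N₀ : ℝ, 1 ≤ C₀ ∧ 0 < N₀ ∧ RadiusComparison (criticalRadius V) C₀ N₀) ∧
    -- admissible `δ`, `η`, `A` exist, depending on the weight only through a bound for `[ω]`
    (∀ K : ℝ≥0, ∃ δ η A : ℝ, 0 < δ ∧ δ < 1 ∧ 1 < η ∧ 0 < A ∧
      ∀ ω : E d → ℝ, MemAp p (criticalRadius V) θ₂ ω →
        apConst p (criticalRadius V) θ₂ ω ≤ K →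
        WeightComparison (criticalRadius V) ω δ η A) ∧
    -- part (1), for all admissible constants
    (∀ C₀ N₀ : ℝ, 1 ≤ C₀ → 0 < N₀ → RadiusComparison (criticalRadius V) C₀ N₀ →
      ∀ δ η A : ℝ, 0 < δ → δ < 1 → 1 < η → 0 < A →
      ∀ θ₁ : ℝ, 0 < θ₁ →
      ∃ C : ℝ, 0 < C ∧
        ∀ ω : E d → ℝ, MemAp p (criticalRadius V) θ₂ ω →
          WeightComparison (criticalRadius V) ω δ η A →
          ∀ f : E d → ℝ, MemBLO (criticalRadius V) θ₁ f →
          ∀ (x₀ : E d) (r : ℝ), 0 < r →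
            weightedLowerOsc p ω f (cube x₀ r)
              ≤ ENNReal.ofReal C * apConst p (criticalRadius V) θ₂ ω *
                ENNReal.ofReal ((1 + r / criticalRadius V x₀) ^ ((N₀ + 1) * θ₁ + η / p)) *
                bloNorm (criticalRadius V) θ₁ f) ∧
    -- part (2)
    (∃ c : ℝ, 0 < c ∧
      ∀ ω : E d → ℝ, MemAp p (criticalRadius V) θ₂ ω →
      ∀ f : E d → ℝ, AEMeasurable f volume →
      ∀ θ₁ C : ℝ, 0 < θ₁ → 0 < C →
        (∀ (x₀ : E d) (r : ℝ), 0 < r →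
          weightedLowerOsc p ω f (cube x₀ r)
            ≤ ENNReal.ofReal C * apConst p (criticalRadius V) θ₂ ω *
              ENNReal.ofReal ((1 + r / criticalRadius V x₀) ^ (θ₁ - θ₂))) →
        MemBLO (criticalRadius V) θ₁ f ∧
          bloNorm (criticalRadius V) θ₁ f
            ≤ (ENNReal.ofReal (c * C) * apConst p (criticalRadius V) θ₂ ω) *
              apConst p (criticalRadius V) θ₂ ω) := by
  have hd0 : 0 < d := by omega
  obtain ⟨hρ, C₀, N₀, hC₀, hN₀, hcomp⟩ :=
    criticalRadius_pos_and_exists_radiusComparison hd hV_nonneg hV_int hV_ne hs hV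
  refine ⟨⟨C₀, N₀, hC₀, hN₀, hcomp⟩,
    exists_weightComparison hd0 hp hθ₂ hρ hC₀ hN₀ hcomp, ?_, ?_⟩
  · intro C₁ N₁ hC₁ hN₁ hcomp₁ δ η A hδ _ _ hA θ₁ hθ₁
    exact weightedLowerOsc_le hd0 hp hρ hC₁ hN₁ hcomp₁ hδ hA hθ₁
  · refine ⟨(2 * √d) ^ d * √d ^ θ₂, by positivity, ?_⟩
    intro ω hω f hf θ₁ C _ _ h
    exact bloNorm_le_of_weightedLowerOsc_le hd0 hp hθ₂ hρ hω hf h
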